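/- For a row vector with entries in $\{0,1,\square\}$, where $\square$ denotes a missing entry, let $d(u,w)$ be the number of positions $j$ with $u[j]\neq w[j]$, $u[j]\ne\square$ and $w[j]\neq\square$. For a matrix $\mathbf T\in\{0,1\}^{n\times\ell}$ let $\delta(\mathbf T)=\max_{i\ne i'}d(\mathbf T[i],\mathbf T[i'])$ be its diameter (the maximum distance between two of its rows; $0$ if $n\le1$). The problem $(0,2)$-DMC asks, given $\mathbf S\in\{0,1,\square\}^{n\times\ell}$, whether the missing entries of $\mathbf S$ can be replaced by $0$s and $1$s (entries in the same column possibly differently) so that the resulting matrix $\mathbf T$ satisfies $\delta(\mathbf T)\le 2$. Call a column dirty if it contains both a $0$ and a $1$. 1. $(0,2)$-DMC can be solved in $O(n\ell)$ time: there are one random access machine program and one constant $c$ such that, on every input $\mathbf S\in\{0,1,\square\}^{n\times\ell}$ with $n,\ell\ge0$, the program halts after at most $c(n\ell+1)$ steps with the correct answer. Each step is an assignment, an addition, a truncated subtraction, a multiplication, a comparison, or an indirect read or write of memory, and all numbers written are at most $c(n+1)(\ell+1)$, so that words of logarithmic length suffice. 2. Every matrix $\mathbf T\in\{0,1\}^{n\times\ell}$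 with at least five dirty columns (in particular, every $\mathbf T$ with $\ell\ge5$ all of whose columns are dirty) and with $\delta(\mathbf T)\le2$ has radius at most $1$: there is $v\in\{0,1\}^\ell$ with $d(v,\mathbf T[i])\le1$ for all $i$. 3. If $\mathbf S\in\{0,1,\square\}^{n\times\ell}$ has at least five dirty columns (in particular, if $\ell\ge5$ and all columns of $\mathbf S$ are dirty), then $\mathbf S$ is a yes-instance of $(0,2)$-DMC if and only if $(\mathbf S,1^n)$ is a yes-instance of ConRMC, that is, if and only if there is $v\in\{0,1\}^\ell$ with $d(v,\mathbf S[i])\le 1$ for all $i$. -/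

import Mathlib

namespace MatrixCompletion

/-! ### Matrices with missing entries -/

/-- Matrices over `{0, 1, □}`; the missing entry `□` is `none`. -/
abbrev IncMatrix (n l : ℕ) : Type := Matrix (Fin n) (Fin l) (Option Bool)

/-- Complete matrices over `{0, 1}`. -/
abbrev BinMatrix (n l : ℕ) : Type := Matrix (Fin n) (Fin l) Bool

/-- A complete row vector, viewed as a row vector over `{0, 1, □}`. -/
def toInc {l : ℕ} (v : Fin l → Bool) : Fin l → Option Bool := fun j => some (v j)

/-- The positions at which two row vectors disagree, ignoring missing entries. -/
def diffSet {l : ℕ} (u w : Fin l → Option Bool) : Finset (Fin l) :=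
  Finset.univ.filter fun j => u j ≠ w j ∧ u j ≠ none ∧ w j ≠ none

/-- The Hamming distance of two row vectors, ignoring missing entries. -/
def hdist {l : ℕ} (u w : Fin l → Option Bool) : ℕ := (diffSet u w).card

/-- `T` is a completion of `S`. -/
def IsCompletion {n l : ℕ} (T : BinMatrix n l) (S : IncMatrix n l) : Prop :=
  ∀ i j, S i j = none ∨ S i j = some (T i j)

/-- The minimum Hamming distance of two different rows (`⊤` if there are fewer than two rows). -/
noncomputable def gamma {n l : ℕ} (T : BinMatrix n l) : ℕ∞ :=
  (Finset.univ : Finset (Fin n)).offDiag.inf fun p => (hdist (toInc (T p.1)) (toInc (T p.2)) : ℕ∞)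

/-- The diameter: the maximum Hamming distance of two different rows (`0` if there are fewer than
two rows). -/
def delta {n l : ℕ} (T : BinMatrix n l) : ℕ :=
  (Finset.univ : Finset (Fin n)).offDiag.sup fun p => hdist (toInc (T p.1)) (toInc (T p.2))

/-- A decision problem whose instances are the matrices over `{0, 1, □}`. -/
abbrev MatrixProblem : Type := ∀ n l : ℕ, IncMatrix n l → Prop

/-- `(α, β)`-Diameter Matrix Completion. -/
def DMC (α β : ℕ) : MatrixProblem := fun n l S =>
  ∃ T : BinMatrix n l, IsCompletion T S ∧ (α : ℕ∞) ≤ gamma T ∧ delta T ≤ β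

/-- Constraint Radius Matrix Completion. -/
def ConRMC {n l : ℕ} (S : IncMatrix n l) (r : Fin n → ℕ) : Prop :=
  ∃ v : Fin l → Bool, ∀ i, hdist (toInc v) (S i) ≤ r i

/-- The complete matrix `T` has radius at most `r`. -/
def RadiusLE {n l : ℕ} (T : BinMatrix n l) (r : ℕ) : Prop :=
  ∃ v : Fin l → Bool, ∀ i, hdist (toInc v) (toInc (T i)) ≤ r

/-- A complete matrix, viewed as a matrix over `{0, 1, □}`. -/
def liftMatrix {n l : ℕ} (T : BinMatrix n l) : IncMatrix n l := fun i => toInc (T i)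

/-- The dirty columns: those that contain both a `0` and a `1`. -/
def dirtyCols {n l : ℕ} (S : IncMatrix n l) : Finset (Fin l) :=
  Finset.univ.filter fun j => (∃ i, S i j = some false) ∧ (∃ i, S i j = some true)

/-! ### A random access machine -/

/-- The storage of the machine: registers, which a program names by constants (so that a program
uses only finitely many of them), and a memory whose cells are addressed by register contents. -/
structure Store where
  reg : ℕ → ℕ
  mem : ℕ → ℕ

/-- The comparisons of two registers on which a program can branch. -/
inductive Test where
  | eq (x y : ℕ)
  | lt (x y : ℕ)

/-- The truth value of a comparison. -/
def Test.Holds (b : Test) (s : Store) : Prop :=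
  match b with
  | .eq x y => s.reg x = s.reg y
  | .lt x y => s.reg x < s.reg y

/-- The right-hand sides of register assignments; `load y` reads the memory cell whose address
is in register `y`. -/
inductive Operation where
  | const (k : ℕ)
  | copy (y : ℕ)
  | add (y z : ℕ)
  | sub (y z : ℕ)
  | mul (y z : ℕ)
  | load (y : ℕ)

/-- The value of a right-hand side (subtraction is truncated at `0`). -/
def Operation.value (o : Operation) (s : Store) : ℕ :=
  match o with
  | .const k => k
  | .copy y => s.reg y
  | .add y z => s.reg y + s.reg z
  | .sub y z => s.reg y - s.reg z
  | .mul y z => s.reg y * s.reg z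
  | .load y => s.mem (s.reg y)

/-- Programs. `assign x o` puts the value of `o` into register `x`; `write a x` copies register
`x` into the memory cell whose address is in register `a`. -/
inductive Program where
  | skip
  | assign (x : ℕ) (o : Operation)
  | write (a x : ℕ)
  | seq (p q : Program)
  | ite (b : Test) (p q : Program)
  | loop (b : Test) (p : Program)

/-- `Exec W p s t s'`: started on the store `s`, the program `p` halts after exactly `t` steps with
the store `s'`, and no number greater than `W` is ever written. Every assignment, every memory
write, every evaluation of a comparison and every `skip` is one step. -/
inductive Exec (W : ℕ) : Program → Store → ℕ → Store → Prop where
  | skip (s : Store) : Exec W .skip s 1 s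
  | assign (s : Store) (x : ℕ) (o : Operation) (h : o.value s ≤ W) :
      Exec W (.assign x o) s 1 ⟨Function.update s.reg x (o.value s), s.mem⟩
  | write (s : Store) (a x : ℕ) (h : s.reg x ≤ W) :
      Exec W (.write a x) s 1 ⟨s.reg, Function.update s.mem (s.reg a) (s.reg x)⟩
  | seq {p q : Program} {s s' s'' : Store} {t t' : ℕ}
      (hp : Exec W p s t s') (hq : Exec W q s' t' s'') : Exec W (.seq p q) s (t + t') s''
  | ite_true {b : Test} {p q : Program} {s s' : Store} {t : ℕ}
      (hb : b.Holds s) (hp : Exec W p s t s') : Exec W (.ite b p q) s (t + 1) s'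
  | ite_false {b : Test} {p q : Program} {s s' : Store} {t : ℕ}
      (hb : ¬ b.Holds s) (hq : Exec W q s t s') : Exec W (.ite b p q) s (t + 1) s'
  | loop_true {b : Test} {p : Program} {s s' s'' : Store} {t t' : ℕ}
      (hb : b.Holds s) (hp : Exec W p s t s') (hw : Exec W (.loop b p) s' t' s'') :
      Exec W (.loop b p) s (t + t' + 1) s''
  | loop_false {b : Test} {p : Program} {s : Store}
      (hb : ¬ b.Holds s) : Exec W (.loop b p) s 1 s

/-- The number that encodes an entry: `0` and `1` stand for themselves and `2` for `□`. -/
def code : Option Bool → ℕ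
  | some false => 0
  | some true => 1
  | none => 2

/-- The initial store on input `S`: the numbers of rows and of columns are in registers `0` and `1`,
and the entries are in the memory cells `0, …, n * l - 1`, row by row (entry `(i, j)` in cell
`i * l + j`, with rows and columns counted from `0`); all else is `0`. -/
def input {n l : ℕ} (S : IncMatrix n l) : Store where
  reg := fun x => if x = 0 then n else if x = 1 then l else 0
  mem := fun a => if h : a < n * l then
      code (S (finProdFinEquiv.symm ⟨a, h⟩).1 (finProdFinEquiv.symm ⟨a, h⟩).2) else 0

/-- `Q` is decided by one program in `O(f n l)` steps on `n × l` matrices, using only numbers of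
size `O((n + 1) * (l + 1))`, that is, words of logarithmic length. The answer (`1` for yes and `0`
for no) is left in register `0`. -/
def SolvableInTime (Q : MatrixProblem) (f : ℕ → ℕ → ℕ) : Prop :=
  ∃ (p : Program) (c : ℕ), ∀ (n l : ℕ) (S : IncMatrix n l), ∃ (t : ℕ) (s : Store),
    Exec (c * ((n + 1) * (l + 1))) p (input S) t s ∧ t ≤ c * f n l ∧
      (Q n l S → s.reg 0 = 1) ∧ (¬ Q n l S → s.reg 0 = 0)

end MatrixCompletion

namespace MatrixCompletion

/-! Diameter and radius: fix a row `i₀` and replace each row by the set of columns in which it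
differs from `i₀`. Distances become sizes of symmetric differences and one set is empty, so diameter
two gives sets of size at most two. If they have no common centre at distance one, some set is `{a,
b}`, some nonempty set misses `a` and some nonempty set misses `b`. A two-element set meets every
nonempty one, so every further point lies in one of the latter two sets, each of which adds at most
one point: only four columns are covered (`card_cover_le_four`). Dirty columns are all covered, so
five of them force radius one. A completion keeps dirty columns dirty and its centre is also a
centre of the incomplete matrix; conversely, filling the gaps from a centre gives distances at most
1 + 1 (`DMC_iff_conRMC`).

Linear time, few dirty columns: restricted to four columns there are only 81 row types. Rows of
equal type can share a completion and clean columns can be made constant, so the answer depends only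
on which types occur (`DMC_iff_typesCompletable`), and a fixed decision tree looks it up.

Linear time, five or more dirty columns: a vector is sought that disagrees with each row at most
once, which is a 2-SAT problem. Columns are added one at a time. Trying a value for the new column,
a row that newly disagrees with a flipped column forces the column of its old disagreement to be
flipped as well. Two new disagreements in one row refute the value (`Propagation.clash`); an
exhausted queue yields a valid assignment (`Propagation.tracks`), which is kept without
backtracking. A trial stamps each row at most once, and links between equal entries of a column lead
directly to the affected rows, so a column costs `O(n)`.

The program is written in a small structured language. `wp` is a weakest-precondition calculus with
time credits, and `exec_of_wp` transfers its conclusions to the machine. -/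

theorem hdist_toInc {l : ℕ} (u w : Fin l → Bool) :
    hdist (toInc u) (toInc w) = (Finset.univ.filter fun j => u j ≠ w j).card := by
  simp [hdist, diffSet, toInc]

theorem delta_le_iff {n l : ℕ} (T : BinMatrix n l) (r : ℕ) :
    delta T ≤ r ↔ ∀ i i', (Finset.univ.filter fun j => T i j ≠ T i' j).card ≤ r := by
  simp only [delta, Finset.sup_le_iff, hdist_toInc]
  constructor
  · intro h i i'
    by_cases hi : i = i'
    · simp [hi]
    · exact h (i, i') (by simp [hi])
  · intro h p _
    exact h _ _

theorem DMC_zero_iff {n l β : ℕ} (S : IncMatrix n l) :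
    DMC 0 β n l S ↔ ∃ T : BinMatrix n l, IsCompletion T S ∧
      ∀ i i', (Finset.univ.filter fun j => T i j ≠ T i' j).card ≤ β := by
  simp [DMC, delta_le_iff]

/-! ### Diameter two versus radius one -/

/-- Sets with pairwise symmetric differences of size at most two, one of them empty, that have no
common centre at distance one, cover at most four points. -/
theorem card_cover_le_four {ι α : Type*} [DecidableEq α] (A : ι → Finset α) (i₀ : ι)
    (h₀ : A i₀ = ∅) (hA : ∀ i k, (A i \ A k).card + (A k \ A i).card ≤ 2)
    (hc : ∀ C : Finset α, ∃ i, 2 ≤ (A i \ C).card + (C \ A i).card) (U : Finset α)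
    (hU : ∀ x ∈ U, ∃ i, x ∈ A i) : U.card ≤ 4 := by
  have hle : ∀ i, (A i).card ≤ 2 := fun i => by simpa [h₀] using hA i i₀
  obtain ⟨i₁, h₁⟩ := hc ∅
  have h₁' : (A i₁).card = 2 := le_antisymm (hle _) (by simpa using h₁)
  obtain ⟨a, b, hab, hA₁⟩ := Finset.card_eq_two.1 h₁'
  -- Since `{c}` is not a centre, some set is at distance two or more from it. The empty set is too
  -- close, and so is any set of at most two elements that contains `c`.
  have key : ∀ c, ∃ i, c ∉ A i ∧ 1 ≤ (A i).card := by
    intro c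
    obtain ⟨i, hi⟩ := hc {c}
    refine ⟨i, ?_, ?_⟩
    · intro hci
      have e1 : ({c} : Finset α) \ A i = ∅ := by simpa using hci
      have e2 := Finset.card_sdiff_add_card_inter (A i) {c}
      have e3 : A i ∩ {c} = {c} := by simpa using hci
      have := hle i
      simp only [e1, e3, Finset.card_empty, Finset.card_singleton] at *
      omega
    · by_contra h
      have : A i = ∅ := by
        rw [← Finset.card_eq_zero]; omega
      simp [this] at hi
  obtain ⟨i₂, ha₂, hc₂⟩ := key a
  obtain ⟨i₃, hb₃, hc₃⟩ := key b
  -- As `A i` is no larger than `A i₁`, at least as many points lie in `A i₁ \ A i` as in `A i \ A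
  -- i₁`, and both numbers add up to at most two.
  have small : ∀ i, (A i \ A i₁).card ≤ 1 := by
    intro i
    have e1 := hA i i₁
    have e2 := Finset.card_sdiff_add_card_inter (A i) (A i₁)
    have e3 := Finset.card_sdiff_add_card_inter (A i₁) (A i)
    rw [Finset.inter_comm] at e3
    have := hle i
    omega
  -- A two-element set and a nonempty set disjoint from it have symmetric difference at least three.
  have disj : ∀ i k, Disjoint (A i) (A k) → (A i).card = 2 → 1 ≤ (A k).card → False := by
    intro i k h h2 h1
    have := hA i k
    rw [Finset.sdiff_eq_self_of_disjoint h, Finset.sdiff_eq_self_of_disjoint h.symm] at this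
    omega
  have cover : ∀ x i, x ∈ A i → x ∈ A i₁ ∪ (A i₂ \ A i₁) ∪ (A i₃ \ A i₁) := by
    intro x i hx
    by_contra hn
    have hx₁ : x ∉ A i₁ := fun h => hn (by simp [h])
    have hx₂ : x ∉ A i₂ := fun h => hn (by simp [h, hx₁])
    have hx₃ : x ∉ A i₃ := fun h => hn (by simp [h, hx₁])
    have hmeet : ¬ Disjoint (A i₁) (A i) := fun h =>
      disj i₁ i h h₁' (Finset.card_pos.2 ⟨x, hx⟩)
    have two : ∀ y, y ∈ A i₁ → y ∈ A i → A i = {x, y} := by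
      intro y hy1 hy
      symm
      apply Finset.eq_of_subset_of_card_le
      · intro z hz
        rcases Finset.mem_insert.1 hz with rfl | hz
        · exact hx
        · rwa [Finset.mem_singleton.1 hz]
      · rw [Finset.card_pair (by rintro rfl; exact hx₁ hy1)]
        exact hle i
    have fin : ∀ y k, y ∈ A i₁ → y ∈ A i → y ∉ A k → x ∉ A k → 1 ≤ (A k).card → False := by
      intro y k hy1 hy hyk hxk hk
      have e := two y hy1 hy
      refine disj i k ?_ ?_ hk
      · rw [e]; simp [hyk, hxk]
      · rw [e, Finset.card_pair (by rintro rfl; exact hx₁ hy1)]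
    rw [Finset.not_disjoint_iff] at hmeet
    obtain ⟨y, hy1, hy⟩ := hmeet
    have : y = a ∨ y = b := by simpa [hA₁] using hy1
    -- If `y = a`, then `A i₂` misses both points of `A i = {x, a}`, contradicting `disj`; for `y =
    -- b` the set `A i₃` plays this role.
    rcases this with rfl | rfl
    · exact fin y i₂ hy1 hy ha₂ hx₂ hc₂
    · exact fin y i₃ hy1 hy hb₃ hx₃ hc₃
  have hsub : U ⊆ A i₁ ∪ (A i₂ \ A i₁) ∪ (A i₃ \ A i₁) := by
    intro x hx
    obtain ⟨i, hi⟩ := hU x hx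
    exact cover x i hi
  have c1 := Finset.card_le_card hsub
  have c2 := Finset.card_union_le (A i₁ ∪ (A i₂ \ A i₁)) (A i₃ \ A i₁)
  have c3 := Finset.card_union_le (A i₁) (A i₂ \ A i₁)
  have := small i₂
  have := small i₃
  omega

/-- Over two symbols, `u` and `w` differ exactly where just one of them differs from `z`. This turns
distances between rows into symmetric differences of sets. -/
theorem card_sdiff_add_sdiff_filter_ne {l : ℕ} (u w z : Fin l → Bool) :
    ((Finset.univ.filter fun j => u j ≠ z j) \ (Finset.univ.filter fun j => w j ≠ z j)).card +
    ((Finset.univ.filter fun j => w j ≠ z j) \ (Finset.univ.filter fun j => u j ≠ z j)).card =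
    (Finset.univ.filter fun j => u j ≠ w j).card := by
  rw [← Finset.card_union_of_disjoint]
  · congr 1
    ext j
    simp only [Finset.mem_union, Finset.mem_sdiff, Finset.mem_filter, Finset.mem_univ, true_and]
    cases u j <;> cases w j <;> cases z j <;> simp
  · exact disjoint_sdiff_sdiff

theorem radiusLE_one_of_delta_le_two {n l : ℕ} (T : BinMatrix n l)
    (h5 : 5 ≤ (dirtyCols (liftMatrix T)).card) (hT : delta T ≤ 2) : RadiusLE T 1 := by
  rw [delta_le_iff] at hT
  by_contra hr
  have hpos : (dirtyCols (liftMatrix T)).Nonempty := Finset.card_pos.1 (by omega)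
  obtain ⟨j₀, hj₀⟩ := hpos
  obtain ⟨i₀, -⟩ := (Finset.mem_filter.1 hj₀).2.1
  have := card_cover_le_four (fun i => Finset.univ.filter fun j => T i j ≠ T i₀ j) i₀ (by simp)
    (fun i k => by rw [card_sdiff_add_sdiff_filter_ne]; exact hT i k)
    (fun C => by
      by_contra hC
      push Not at hC
      -- A centre `C` of the sets corresponds to row `i₀` with the columns in `C` flipped.
      refine hr ⟨fun j => if j ∈ C then !(T i₀ j) else T i₀ j, fun i => ?_⟩
      have := hC i
      have hCe : C = Finset.univ.filter
          fun j => (if j ∈ C then !(T i₀ j) else T i₀ j) ≠ T i₀ j := by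
        ext j
        by_cases hj : j ∈ C <;> simp [hj]
      rw [hCe, card_sdiff_add_sdiff_filter_ne] at this
      rw [hdist_toInc]
      refine Nat.le_of_lt_succ (lt_of_eq_of_lt ?_ this)
      exact congrArg Finset.card (Finset.filter_congr fun j _ => ne_comm))
    (dirtyCols (liftMatrix T))
    (fun j hj => by
      obtain ⟨⟨i, hi⟩, k, hk⟩ := (Finset.mem_filter.1 hj).2
      simp only [liftMatrix, toInc, Option.some.injEq] at hi hk
      cases h : T i₀ j
      · exact ⟨k, by simp [h, hk]⟩
      · exact ⟨i, by simp [h, hi]⟩)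
  omega

/-- Completing a matrix can only create dirty columns, and forgetting entries can only decrease
distances to a centre. Conversely, rows completed from `v` differ from `v` at most once each, hence
from one another at most twice. -/
theorem DMC_iff_conRMC {n l : ℕ} (S : IncMatrix n l) (h5 : 5 ≤ (dirtyCols S).card) :
    DMC 0 2 n l S ↔ ConRMC S (fun _ => 1) := by
  constructor
  · rintro ⟨T, hT, -, hd⟩
    have hsub : dirtyCols S ⊆ dirtyCols (liftMatrix T) := by
      intro j hj
      obtain ⟨⟨i, hi⟩, k, hk⟩ := (Finset.mem_filter.1 hj).2
      refine Finset.mem_filter.2 ⟨Finset.mem_univ _, ⟨i, ?_⟩, k, ?_⟩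
      · simpa [hi, liftMatrix, toInc] using (hT i j).symm
      · simpa [hk, liftMatrix, toInc] using (hT k j).symm
    obtain ⟨v, hv⟩ := radiusLE_one_of_delta_le_two T (h5.trans (Finset.card_le_card hsub)) hd
    refine ⟨v, fun i => le_trans (Finset.card_le_card ?_) (hv i)⟩
    intro j hj
    have := hT i j
    simp only [diffSet, Finset.mem_filter, Finset.mem_univ, true_and] at hj ⊢
    simp only [toInc] at hj ⊢
    rcases this with h | h
    · simp [h] at hj
    · simpa [h] using hj
  · rintro ⟨v, hv⟩
    rw [DMC_zero_iff]
    refine ⟨fun i j => (S i j).getD (v j), fun i j => ?_, fun i k => ?_⟩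
    · cases h : S i j <;> simp [h]
    · have e : ∀ i, (Finset.univ.filter fun j => (S i j).getD (v j) ≠ v j).card ≤ 1 := by
        intro i
        refine le_trans (Finset.card_le_card ?_) (hv i)
        intro j hj
        simp only [diffSet, toInc, Finset.mem_filter, Finset.mem_univ, true_and] at hj ⊢
        cases h : S i j
        · simp [h] at hj
        · simpa [h, eq_comm] using hj
      beta_reduce
      rw [← card_sdiff_add_sdiff_filter_ne _ _ v]
      have h1 := (Finset.card_le_card (Finset.sdiff_subset
        (s := Finset.univ.filter fun j => (S i j).getD (v j) ≠ v j)
        (t := Finset.univ.filter fun j => (S k j).getD (v j) ≠ v j))).trans (e i)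
      have h2 := (Finset.card_le_card (Finset.sdiff_subset
        (s := Finset.univ.filter fun j => (S k j).getD (v j) ≠ v j)
        (t := Finset.univ.filter fun j => (S i j).getD (v j) ≠ v j))).trans (e k)
      omega

/-! ### A structured language with named registers and arrays -/

/-- Named registers. -/
inductive Reg where
  | rows | cols | cells | zero | one | pos | row | col | tmpA | tmpB | tmpC | entry | dirties | ans
  | tag | head | tail | clash | cur | old | addr | next | partner
  deriving DecidableEq

/-- Named arrays. -/
inductive Arr where
  | prev | dirty | mark | val | mis | flip | stamp | cause | queue
  deriving DecidableEq

/-- The machine register that holds a named register. -/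
def Reg.idx : Reg → ℕ
  | rows => 4 | cols => 5 | cells => 6 | zero => 7 | one => 8 | pos => 9 | row => 10 | col => 11
  | tmpA => 12 | tmpB => 13 | tmpC => 14 | entry => 15 | dirties => 16 | ans => 17 | tag => 18
  | head => 19 | tail => 20 | clash => 21 | cur => 22 | old => 23 | addr => 24 | next => 25
  | partner => 26

/-- The number of a named array. -/
def Arr.idx : Arr → ℕ
  | prev => 0 | dirty => 1 | mark => 2 | val => 3 | mis => 4 | flip => 5 | stamp => 6 | cause => 7
  | queue => 8

theorem Reg.four_le_idx (x : Reg) : 4 ≤ x.idx := by cases x <;> simp [idx]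

theorem Reg.idx_injective : Function.Injective Reg.idx := by
  have h : ∀ x : Reg, ∀ y : Reg, x.idx = y.idx → x = y := by
    intro x y
    cases x <;> cases y <;> simp [idx]
  exact fun x y => h x y

theorem Arr.idx_lt (a : Arr) : a.idx < 16 := by cases a <;> simp [idx]

theorem Arr.idx_injective : Function.Injective Arr.idx := by
  intro x y
  cases x <;> cases y <;> simp [idx]

/-- States of the structured language. -/
structure St where
  r : Reg → ℕ
  A : Arr → ℕ → ℕ

/-- Overwrite a register. -/
def St.setr (σ : St) (x : Reg) (v : ℕ) : St := ⟨fun y => if y = x then v else σ.r y, σ.A⟩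

/-- Overwrite an array cell. -/
def St.seta (σ : St) (a : Arr) (i v : ℕ) : St :=
  ⟨σ.r, fun a' i' => if a' = a ∧ i' = i then v else σ.A a' i'⟩

@[simp] theorem St.setr_r (σ : St) (x y : Reg) (v : ℕ) :
    (σ.setr x v).r y = if y = x then v else σ.r y := rfl
@[simp] theorem St.setr_A (σ : St) (x : Reg) (v : ℕ) : (σ.setr x v).A = σ.A := rfl
@[simp] theorem St.seta_r (σ : St) (a : Arr) (i v : ℕ) : (σ.seta a i v).r = σ.r := rfl
@[simp] theorem St.seta_A (σ : St) (a : Arr) (i v : ℕ) (a' : Arr) (i' : ℕ) :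
    (σ.seta a i v).A a' i' = if a' = a ∧ i' = i then v else σ.A a' i' := rfl

/-- Tests of the structured language. -/
inductive Cond where
  | eq (x y : Reg)
  | lt (x y : Reg)

/-- The truth value of a test. -/
def Cond.Holds (b : Cond) (σ : St) : Prop :=
  match b with
  | .eq x y => σ.r x = σ.r y
  | .lt x y => σ.r x < σ.r y

@[simp] theorem Cond.holds_eq (x y : Reg) (σ : St) : (Cond.eq x y).Holds σ ↔ σ.r x = σ.r y :=
  Iff.rfl
@[simp] theorem Cond.holds_lt (x y : Reg) (σ : St) : (Cond.lt x y).Holds σ ↔ σ.r x < σ.r y :=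
  Iff.rfl

instance (b : Cond) (σ : St) : Decidable (b.Holds σ) := by
  cases b <;> simp only [Cond.Holds] <;> infer_instance

/-- The machine test for a test of the structured language. -/
def Cond.compile : Cond → Test
  | .eq x y => .eq x.idx y.idx
  | .lt x y => .lt x.idx y.idx

/-- Commands of the structured language; `read x i` reads the input cell with address `i`, `load`
and `store` access arrays. -/
inductive Cmd where
  | skip
  | set (x : Reg) (k : ℕ)
  | mov (x y : Reg)
  | add (x y w : Reg)
  | sub (x y w : Reg)
  | mul (x y w : Reg)
  | read (x i : Reg)
  | load (x : Reg) (a : Arr) (i : Reg)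
  | store (a : Arr) (i x : Reg)
  | seq (p q : Cmd)
  | ite (b : Cond) (p q : Cmd)
  | loop (b : Cond) (p : Cmd)

infixr:60 " ;; " => Cmd.seq

/-- Put the address of cell `i` of array `a` into machine register `0`. -/
def address (a : Arr) (i : Reg) : Program :=
  .seq (.assign 0 (.mul i.idx 2)) (.seq (.assign 0 (.add 0 3))
    (.seq (.assign 1 (.const a.idx)) (.assign 0 (.add 0 1))))

/-- The machine program for a command. -/
def Cmd.compile : Cmd → Program
  | .skip => .skip
  | .set x k => .assign x.idx (.const k)
  | .mov x y => .assign x.idx (.copy y.idx)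
  | .add x y w => .assign x.idx (.add y.idx w.idx)
  | .sub x y w => .assign x.idx (.sub y.idx w.idx)
  | .mul x y w => .assign x.idx (.mul y.idx w.idx)
  | .read x i => .assign x.idx (.load i.idx)
  | .load x a i => .seq (address a i) (.assign x.idx (.load 0))
  | .store a i x => .seq (address a i) (.write 0 x.idx)
  | .seq p q => .seq p.compile q.compile
  | .ite b p q => .ite b.compile p.compile q.compile
  | .loop b p => .loop b.compile p.compile

/-! ### Memory layout, time credits and simulation by the machine -/

open Classical in
/-- The machine memory: the input, followed by the interleaved arrays. -/
noncomputable def layout (M : ℕ) (inp : ℕ → ℕ) (A : Arr → ℕ → ℕ) : ℕ → ℕ := fun q =>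
  if q < M then inp q
  else if h : ∃ a : Arr, a.idx = (q - M) % 16 then A h.choose ((q - M) / 16) else 0

theorem layout_of_lt {M : ℕ} {inp : ℕ → ℕ} {A : Arr → ℕ → ℕ} {q : ℕ} (h : q < M) :
    layout M inp A q = inp q := by simp [layout, h]

/-- Array indices are distinct and below 16, so the offset modulo 16 recovers the array and the
quotient recovers the cell. -/
theorem layout_cell (M : ℕ) (inp : ℕ → ℕ) (A : Arr → ℕ → ℕ) (a : Arr) (i : ℕ) :
    layout M inp A (i * 16 + M + a.idx) = A a i := by
  have ha := a.idx_lt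
  have hex : ∃ a' : Arr, a'.idx = (i * 16 + M + a.idx - M) % 16 := ⟨a, by omega⟩
  have h1 : (i * 16 + M + a.idx - M) / 16 = i := by omega
  have h2 : hex.choose = a := Arr.idx_injective (hex.choose_spec.trans (by omega))
  unfold layout
  rw [if_neg (by omega), dif_pos hex, h1, h2]

theorem layout_update (M : ℕ) (inp : ℕ → ℕ) (σ : St) (a : Arr) (i v : ℕ) :
    Function.update (layout M inp σ.A) (i * 16 + M + a.idx) v =
      layout M inp (σ.seta a i v).A := by
  funext q
  have ha := a.idx_lt
  by_cases hq : q = i * 16 + M + a.idx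
  · subst hq
    rw [Function.update_self, layout_cell]
    simp
  · rw [Function.update_of_ne hq]
    unfold layout
    split_ifs with h1 h2
    · rfl
    · have h3 := h2.choose_spec
      rw [St.seta_A, if_neg]
      rintro ⟨e1, e2⟩
      rw [e1] at h3
      omega
    · rfl

/-- The machine store `s` represents the state `σ`, all of whose numbers are at most `B`. -/
structure Represents (B M : ℕ) (inp : ℕ → ℕ) (σ : St) (s : Store) : Prop where
  reg : ∀ x : Reg, s.reg x.idx = σ.r x
  two : s.reg 2 = 16
  three : s.reg 3 = M
  mem : s.mem = layout M inp σ.A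
  reg_le : ∀ x, σ.r x ≤ B
  arr_le : ∀ a i, σ.A a i ≤ B

/-- Weakest preconditions with time credits: `wp B M inp p Q σ T` guarantees that `p` started on
`σ` with credit `T` halts in a state and with a remaining credit that satisfy `Q`. -/
def wp (B M : ℕ) (inp : ℕ → ℕ) : Cmd → (St → ℤ → Prop) → St → ℤ → Prop
  | .skip, Q, σ, T => Q σ (T - 1)
  | .set x k, Q, σ, T => k ≤ B ∧ Q (σ.setr x k) (T - 1)
  | .mov x y, Q, σ, T => Q (σ.setr x (σ.r y)) (T - 1)
  | .add x y w, Q, σ, T => σ.r y + σ.r w ≤ B ∧ Q (σ.setr x (σ.r y + σ.r w)) (T - 1)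
  | .sub x y w, Q, σ, T => Q (σ.setr x (σ.r y - σ.r w)) (T - 1)
  | .mul x y w, Q, σ, T => σ.r y * σ.r w ≤ B ∧ Q (σ.setr x (σ.r y * σ.r w)) (T - 1)
  | .read x i, Q, σ, T => σ.r i < M ∧ Q (σ.setr x (inp (σ.r i))) (T - 1)
  | .load x a i, Q, σ, T => Q (σ.setr x (σ.A a (σ.r i))) (T - 5)
  | .store a i x, Q, σ, T => Q (σ.seta a (σ.r i) (σ.r x)) (T - 5)
  | .seq p q, Q, σ, T => wp B M inp p (wp B M inp q Q) σ T
  | .ite b p q, Q, σ, T =>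
      (b.Holds σ → wp B M inp p Q σ (T - 1)) ∧ (¬ b.Holds σ → wp B M inp q Q σ (T - 1))
  | .loop b p, Q, σ, T => ∃ I : St → ℤ → Prop, I σ T ∧ ∀ σ' T', I σ' T' → 0 ≤ T' ∧
      (b.Holds σ' → wp B M inp p I σ' (T' - 1)) ∧ (¬ b.Holds σ' → Q σ' (T' - 1))

section
variable {B M W : ℕ} {inp : ℕ → ℕ}

theorem Represents.setr {σ : St} {s : Store} (h : Represents B M inp σ s) (x : Reg) (v : ℕ)
    (hv : v ≤ B) :
    Represents B M inp (σ.setr x v) ⟨Function.update s.reg x.idx v, s.mem⟩ where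
  reg y := by
    by_cases hy : y = x
    · simp [hy]
    · have : y.idx ≠ x.idx := fun e => hy (Reg.idx_injective e)
      simp [hy, this, h.reg]
  two := by
    have : 2 ≠ x.idx := by have := x.four_le_idx; omega
    simp [this, h.two]
  three := by
    have : 3 ≠ x.idx := by have := x.four_le_idx; omega
    simp [this, h.three]
  mem := h.mem
  reg_le y := by
    rw [St.setr_r]
    split_ifs
    exacts [hv, h.reg_le y]
  arr_le := h.arr_le

/-- Machine registers 0 and 1 hold nothing that is represented, so address computations may
overwrite them. -/
theorem Represents.scratch {σ : St} {s : Store} (h : Represents B M inp σ s) (y v : ℕ)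
    (hy : y < 2) : Represents B M inp σ ⟨Function.update s.reg y v, s.mem⟩ where
  reg x := by
    have : x.idx ≠ y := by have := x.four_le_idx; omega
    simp [this, h.reg]
  two := by simp [(show 2 ≠ y by omega), h.two]
  three := by simp [(show 3 ≠ y by omega), h.three]
  mem := h.mem
  reg_le := h.reg_le
  arr_le := h.arr_le

theorem Cond.compile_holds {σ : St} {s : Store} (h : Represents B M inp σ s) (b : Cond) :
    b.compile.Holds s ↔ b.Holds σ := by
  cases b <;> simp [Cond.compile, Test.Holds, h.reg]

theorem exec_assign_of_eq {s : Store} (x : ℕ) (o : Operation) {v : ℕ} (hv : o.value s = v)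
    (h : v ≤ W) : Exec W (.assign x o) s 1 ⟨Function.update s.reg x v, s.mem⟩ := by
  subst hv
  exact .assign s x o h

theorem exec_address (hW : 16 * B + M + 16 ≤ W) {σ : St} {s : Store}
    (h : Represents B M inp σ s) (a : Arr) (i : Reg) :
    ∃ s', Exec W (address a i) s 4 s' ∧ Represents B M inp σ s' ∧
      s'.reg 0 = σ.r i * 16 + M + a.idx := by
  have ha := a.idx_lt
  have hi := h.reg_le i
  have h0 := h.scratch 0 (σ.r i * 16) (by omega)
  have h1 := h0.scratch 0 (σ.r i * 16 + M) (by omega)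
  have h2 := h1.scratch 1 a.idx (by omega)
  have h3 := h2.scratch 0 (σ.r i * 16 + M + a.idx) (by omega)
  refine ⟨_, ?_, h3, by simp⟩
  exact .seq (t := 1) (t' := 3)
    (exec_assign_of_eq 0 _ (by simp only [Operation.value, h.reg, h.two]) (by omega))
    (.seq (t := 1) (t' := 2)
      (exec_assign_of_eq 0 _ (by simpa [Operation.value] using h.three)
        (by omega))
      (.seq (t := 1) (t' := 1) (exec_assign_of_eq 1 _ (by simp only [Operation.value]) (by omega))
        (exec_assign_of_eq 0 _ (by simp [Operation.value]) (by omega))))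

/-- Soundness of `wp`. Addresses are at most `16 * B + M + 16` when all represented numbers are at
most `B`, which explains the bound on `W`. -/
theorem exec_of_wp (hW : 16 * B + M + 16 ≤ W) (hinp : ∀ q < M, inp q ≤ B) (p : Cmd) :
    ∀ (Q : St → ℤ → Prop) (σ : St) (T : ℤ), wp B M inp p Q σ T →
      ∀ s, Represents B M inp σ s → ∃ (t : ℕ) (s' : Store) (σ' : St),
        Exec W p.compile s t s' ∧ Represents B M inp σ' s' ∧ Q σ' (T - t) := by
  induction p with
  | skip =>
    intro Q σ T h s hs
    exact ⟨1, s, σ, .skip s, hs, by simpa [wp] using h⟩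
  | set x k =>
    intro Q σ T h s hs
    exact ⟨1, _, _, exec_assign_of_eq _ _ (v := k) rfl (by have := h.1; omega), hs.setr x k h.1,
      by simpa [wp] using h.2⟩
  | mov x y =>
    intro Q σ T h s hs
    have := hs.reg_le y
    exact ⟨1, _, _, exec_assign_of_eq _ _ (hs.reg y) (by omega), hs.setr x _ this,
      by simpa [wp] using h⟩
  | add x y w =>
    intro Q σ T h s hs
    have := h.1
    exact ⟨1, _, _, exec_assign_of_eq _ _ (v := σ.r y + σ.r w)
      (by simp [Operation.value, hs.reg]) (by omega),
      hs.setr x _ h.1, by simpa [wp] using h.2⟩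
  | sub x y w =>
    intro Q σ T h s hs
    have := hs.reg_le y
    exact ⟨1, _, _, exec_assign_of_eq _ _ (v := σ.r y - σ.r w)
      (by simp [Operation.value, hs.reg]) (by omega),
      hs.setr x _ (by omega), by simpa [wp] using h⟩
  | mul x y w =>
    intro Q σ T h s hs
    have := h.1
    exact ⟨1, _, _, exec_assign_of_eq _ _ (v := σ.r y * σ.r w)
      (by simp [Operation.value, hs.reg]) (by omega),
      hs.setr x _ h.1, by simpa [wp] using h.2⟩
  | read x i =>
    intro Q σ T h s hs
    have := hinp _ h.1
    refine ⟨1, _, _, exec_assign_of_eq _ _ (v := inp (σ.r i)) ?_ (by omega), hs.setr x _ this,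
      by simpa [wp] using h.2⟩
    simp only [Operation.value, hs.reg, hs.mem]
    exact layout_of_lt h.1
  | load x a i =>
    intro Q σ T h s hs
    obtain ⟨s', h1, h2, h3⟩ := exec_address hW hs a i
    have := hs.arr_le a (σ.r i)
    refine ⟨4 + 1, _, _, .seq h1 (exec_assign_of_eq _ _ (v := σ.A a (σ.r i)) ?_ (by omega)),
      h2.setr x _ this, by simpa [wp] using h⟩
    simp only [Operation.value, h3, h2.mem, layout_cell]
  | store a i x =>
    intro Q σ T h s hs
    obtain ⟨s', h1, h2, h3⟩ := exec_address hW hs a i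
    have hx := hs.reg_le x
    refine ⟨4 + 1, _, σ.seta a (σ.r i) (σ.r x), .seq h1 (.write _ _ _ ?_),
      ⟨fun y => h2.reg y, h2.two, h2.three, ?_, hs.reg_le, ?_⟩, by simpa [wp] using h⟩
    · rw [h2.reg]; omega
    · simp only [h3, h2.mem, h2.reg, layout_update]
    · intro a' i'
      rw [St.seta_A]
      split_ifs
      exacts [hx, hs.arr_le a' i']
  | seq p q ihp ihq =>
    intro Q σ T h s hs
    obtain ⟨t, s', σ', h1, h2, h3⟩ := ihp _ σ T h s hs
    obtain ⟨t', s'', σ'', h4, h5, h6⟩ := ihq _ σ' _ h3 s' h2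
    exact ⟨t + t', s'', σ'', .seq h1 h4, h5, by simpa [sub_sub] using h6⟩
  | ite b p q ihp ihq =>
    intro Q σ T h s hs
    by_cases hb : b.Holds σ
    · obtain ⟨t, s', σ', h1, h2, h3⟩ := ihp _ σ _ (h.1 hb) s hs
      refine ⟨t + 1, s', σ', .ite_true ((b.compile_holds hs).2 hb) h1, h2, ?_⟩
      convert h3 using 1; push_cast; ring
    · obtain ⟨t, s', σ', h1, h2, h3⟩ := ihq _ σ _ (h.2 hb) s hs
      refine ⟨t + 1, s', σ', .ite_false (mt (b.compile_holds hs).1 hb) h1, h2, ?_⟩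
      convert h3 using 1; push_cast; ring
  | loop b p ih =>
    rintro Q σ T ⟨I, hI, hstep⟩ s hs
    -- The invariant keeps the credit nonnegative and every test spends one unit, so the credit
    -- bounds the number of iterations. With credit 0 the body would have to re-establish the
    -- invariant at a negative credit.
    have main : ∀ N : ℕ, ∀ σ T s, T.toNat ≤ N → I σ T → Represents B M inp σ s →
        ∃ (t : ℕ) (s' : Store) (σ' : St), Exec W (Cmd.loop b p).compile s t s' ∧
          Represents B M inp σ' s' ∧ Q σ' (T - t) := by
      intro N
      induction N with
      | zero =>
        intro σ T s hT hI hs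
        obtain ⟨h0, h1, h2⟩ := hstep σ T hI
        have : T = 0 := by omega
        subst this
        by_cases hb : b.Holds σ
        · obtain ⟨t, s', σ', -, -, h5⟩ := ih _ σ _ (h1 hb) s hs
          have := (hstep _ _ h5).1
          omega
        · exact ⟨1, s, σ, .loop_false (mt (b.compile_holds hs).1 hb), hs, by simpa using h2 hb⟩
      | succ N ihN =>
        intro σ T s hT hI hs
        obtain ⟨h0, h1, h2⟩ := hstep σ T hI
        by_cases hb : b.Holds σ
        · obtain ⟨t, s', σ', h3, h4, h5⟩ := ih _ σ _ (h1 hb) s hs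
          obtain ⟨t', s'', σ'', h6, h7, h8⟩ := ihN σ' _ s' (by omega) h5 h4
          refine ⟨t + t' + 1, s'', σ'', .loop_true ((b.compile_holds hs).2 hb) h3 h6, h7, ?_⟩
          convert h8 using 1; push_cast; ring
        · exact ⟨1, s, σ, .loop_false (mt (b.compile_holds hs).1 hb), hs, by simpa using h2 hb⟩
    exact main _ σ T s le_rfl hI hs

/-- Both branches write the same cell at the same cost, so the case distinction moves into the
written value and the goals do not double. -/
theorem wp_ite_store (b : Cond) (a : Arr) (i x y : Reg) (Q : St → ℤ → Prop) (σ : St) (T : ℤ)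
    [Decidable (b.Holds σ)] :
    wp B M inp (.ite b (.store a i x) (.store a i y)) Q σ T ↔
      Q (σ.seta a (σ.r i) (if b.Holds σ then σ.r x else σ.r y)) (T - 6) := by
  by_cases hb : b.Holds σ <;> simp [wp, hb, sub_sub]

end

/-! ### Links between equal entries of a column -/

/-- One plus the last row before row `i` whose entry in column `j` is `a`; `0` if there is none. -/
def prevRow (E : ℕ → ℕ → ℕ) (j a : ℕ) : ℕ → ℕ
  | 0 => 0
  | i + 1 => if E i j = a then i + 1 else prevRow E j a i

theorem prevRow_le (E : ℕ → ℕ → ℕ) (j a i : ℕ) : prevRow E j a i ≤ i := by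
  induction i with
  | zero => simp [prevRow]
  | succ i ih => rw [prevRow]; split_ifs <;> omega

theorem entry_prevRow (E : ℕ → ℕ → ℕ) (j a i : ℕ) (h : 0 < prevRow E j a i) :
    E (prevRow E j a i - 1) j = a := by
  induction i with
  | zero => simp [prevRow] at h
  | succ i ih =>
    rw [prevRow] at h ⊢
    split_ifs at h ⊢ with h1
    · simpa using h1
    · exact ih h

/-- Following the links skips no row with entry `a`; this makes a scan along them exhaustive. -/
theorem entry_ne_of_prevRow_le (E : ℕ → ℕ → ℕ) (j a i : ℕ) {k : ℕ} (h : prevRow E j a i ≤ k)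
    (hk : k < i) : E k j ≠ a := by
  induction i with
  | zero => omega
  | succ i ih =>
    rw [prevRow] at h
    split_ifs at h with h1
    · omega
    · rcases Nat.lt_succ_iff_lt_or_eq.1 hk with h2 | rfl
      · exact ih h h2
      · exact h1

theorem prevRow_pos_iff (E : ℕ → ℕ → ℕ) (j a n : ℕ) :
    0 < prevRow E j a n ↔ ∃ i < n, E i j = a := by
  constructor
  · intro h
    have := prevRow_le E j a n
    exact ⟨_, by omega, entry_prevRow E j a n h⟩
  · rintro ⟨i, hi, h⟩
    by_contra h0
    exact entry_ne_of_prevRow_le E j a n (k := i) (by omega) hi h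

/-- The registers that hold constants have their values. -/
def Consts (n l M : ℕ) (σ : St) : Prop :=
  σ.r .rows = n ∧ σ.r .cols = l ∧ σ.r .cells = M ∧ σ.r .zero = 0 ∧ σ.r .one = 1

/-- The array `prev` holds the values of `prevRow`. -/
def HasPrev (n l : ℕ) (inp : ℕ → ℕ) (P : ℕ → ℕ) : Prop :=
  ∀ i ≤ n, ∀ j < l, ∀ a < 2, P (2 * (i * l + j) + a) = prevRow (fun i j => inp (i * l + j)) j a i

/-- Fill the array `prev`. -/
def buildPrev : Cmd :=
  .set .pos 0 ;; .set .row 1 ;; .set .col 0 ;;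
  .loop (.lt .pos .cells)
    (.read .entry .pos ;;
      -- `tmpA` addresses the links of the current cell and `tmpB` those of the cell below it. The
      -- links of row 0 are the initial zeros.
      .add .tmpA .pos .pos ;;
      .add .tmpB .pos .cols ;; .add .tmpB .tmpB .tmpB ;;
      .load .tmpC .prev .tmpA ;;
      .ite (.eq .entry .zero) (.store .prev .tmpB .row) (.store .prev .tmpB .tmpC) ;;
      .add .tmpA .tmpA .one ;; .add .tmpB .tmpB .one ;;
      .load .tmpC .prev .tmpA ;;
      .ite (.eq .entry .one) (.store .prev .tmpB .row) (.store .prev .tmpB .tmpC) ;;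
      .add .pos .pos .one ;; .add .col .col .one ;;
      .ite (.eq .col .cols) (.set .col 0 ;; .add .row .row .one) .skip)

theorem wp_buildPrev {n l M B : ℕ} {inp : ℕ → ℕ} (hM : M = n * l) (hl : 0 < l)
    (hB : 4 * M + 10 * n + 10 * l + 200 ≤ B) (σ : St) (T : ℤ) (hσ : Consts n l M σ)
    (h0 : ∀ q, σ.A .prev q = 0) (hT : 40 * M + 10 ≤ T) (Q : St → ℤ → Prop)
    (hQ : ∀ σ' T', Consts n l M σ' → HasPrev n l inp (σ'.A .prev) →
      (∀ a, a ≠ .prev → ∀ q, σ'.A a q = σ.A a q) → T - 40 * M - 10 ≤ T' → Q σ' T') :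
    wp B M inp buildPrev Q σ T := by
  obtain ⟨c1, c2, c3, c4, c5⟩ := hσ
  simp only [buildPrev, ↓wp_ite_store, wp]
  -- Before cell `pos` is read, the links of all cells below `pos + l` are known, because each cell
  -- determines the links one row further down.
  refine ⟨by omega, by omega, by omega, fun σ' T' => Consts n l M σ' ∧ σ'.r .pos ≤ M ∧
    σ'.r .row = σ'.r .pos / l + 1 ∧ σ'.r .col = σ'.r .pos % l ∧
    (∀ q < σ'.r .pos + l, ∀ a < 2, σ'.A .prev (2 * q + a) =
      prevRow (fun i j => inp (i * l + j)) (q % l) a (q / l)) ∧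
    (∀ a, a ≠ .prev → ∀ q, σ'.A a q = σ.A a q) ∧
    T - 40 * M - 9 + 40 * (M - σ'.r .pos) ≤ T', ?_, ?_⟩
  · refine ⟨by simp [Consts, *], by simp, by simp, by simp, ?_, by simp, by simp; omega⟩
    intro q hq a ha
    simp at hq
    simp [h0, Nat.div_eq_of_lt hq, prevRow]
  · rintro τ S ⟨⟨d1, d2, d3, d4, d5⟩, hp, hr, hc, hP, hA, hS⟩
    refine ⟨by omega, fun hb => ?_, fun hb => ?_⟩
    · simp only [Cond.holds_lt] at hb
      have hpM : τ.r .pos < M := by omega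
      have hdl : τ.r .pos / l < n := by
        rw [Nat.div_lt_iff_lt_mul hl]; omega
      have hdm := Nat.div_add_mod (τ.r .pos) l
      have hml := Nat.mod_lt (τ.r .pos) hl
      simp only [St.setr_r, St.setr_A, St.seta_r, St.seta_A, Cond.holds_eq, reduceCtorEq, if_true,
        if_false, d1, d2, d3, d4, d5, Consts, and_self, true_and]
      have hstep : (τ.r .col + 1 = l → (τ.r .pos + 1) / l = τ.r .pos / l + 1 ∧
          (τ.r .pos + 1) % l = 0) ∧ (¬ τ.r .col + 1 = l → (τ.r .pos + 1) / l = τ.r .pos / l ∧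
          (τ.r .pos + 1) % l = τ.r .col + 1) := by
        constructor
        · intro h
          rw [Nat.div_mod_unique hl, Nat.mul_add]
          omega
        · intro h
          rw [Nat.div_mod_unique hl]
          omega
      have hnew : ∀ a < 2, prevRow (fun i j => inp (i * l + j)) ((τ.r .pos + l) % l) a
          ((τ.r .pos + l) / l) = if inp (τ.r .pos) = a then τ.r .row else
            τ.A .prev (2 * τ.r .pos + a) := by
        intro a ha
        rw [Nat.add_div_right _ hl, Nat.add_mod_right, prevRow, hP _ (by omega) a ha, hr,
          Nat.mul_comm _ l, hdm]
      have hold := hP (τ.r .pos)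
      refine ⟨hpM, by omega, by omega, by omega, by omega, by omega, by omega, by omega,
        fun h => ⟨by omega, by omega, by omega, by omega, by omega, ?_, ?_, by omega⟩,
        fun h => ⟨by omega, by omega, by omega, ?_, ?_, by omega⟩⟩
      all_goals first
        | (intro a ha q
           simpa [ha] using hA a ha q)
        | (intro q hq a ha
           by_cases hq' : q = τ.r .pos + l
           · subst hq'
             rw [hnew a ha]
             interval_cases a
             · rw [if_neg (by omega), if_pos (by omega)]
               simp [two_mul]
             · have h1 : ¬ (τ.r .pos + τ.r .pos + 1 = τ.r .pos + l + (τ.r .pos + l)) := by omega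
               rw [if_pos (by omega), if_neg h1, two_mul]
           · rw [if_neg (by omega), if_neg (by omega)]
             exact hP q (by omega) a ha)
    · simp only [Cond.holds_lt] at hb
      refine hQ _ _ ⟨d1, d2, d3, d4, d5⟩ ?_ hA (by omega)
      intro i hi j hj a ha
      have h1 : i * l ≤ M := hM ▸ Nat.mul_le_mul_right l hi
      rw [hP _ (by omega) a ha]
      rw [show (i * l + j) % l = j by rw [Nat.mul_comm, Nat.mul_add_mod, Nat.mod_eq_of_lt hj],
        show (i * l + j) / l = i by
        rw [Nat.mul_comm, Nat.mul_add_div hl, Nat.div_eq_of_lt hj, add_zero]]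

/-! ### Finding the dirty columns -/

/-- Column `j` of the encoded matrix contains both a `0` and a `1`. -/
def IsDirty (n l : ℕ) (inp : ℕ → ℕ) (j : ℕ) : Prop :=
  (∃ i < n, inp (i * l + j) = 0) ∧ ∃ i < n, inp (i * l + j) = 1

open Classical in
/-- The dirty ones among the first `k` columns. -/
noncomputable def dirtyList (n l : ℕ) (inp : ℕ → ℕ) (k : ℕ) : List ℕ :=
  (List.range k).filter fun j => IsDirty n l inp j

/-- List the dirty columns in the array `dirty`. -/
def findDirty : Cmd :=
  .set .col 0 ;; .set .dirties 0 ;;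
  .loop (.lt .col .cols)
    -- The links of the fictitious row `n` are nonzero exactly for the values that occur in the
    -- column.
    (.add .tmpA .cells .col ;; .add .tmpA .tmpA .tmpA ;;
      .load .tmpB .prev .tmpA ;; .add .tmpA .tmpA .one ;; .load .tmpC .prev .tmpA ;;
      .ite (.lt .zero .tmpB)
        (.ite (.lt .zero .tmpC)
          (.store .dirty .dirties .col ;; .add .dirties .dirties .one ;; .add .col .col .one)
          (.add .col .col .one))
        (.add .col .col .one))

theorem dirtyList_succ (n l : ℕ) (inp : ℕ → ℕ) (k : ℕ) [Decidable (IsDirty n l inp k)] :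
    dirtyList n l inp (k + 1) =
      if IsDirty n l inp k then dirtyList n l inp k ++ [k] else dirtyList n l inp k := by
  unfold dirtyList
  rw [List.range_succ, List.filter_append]
  split_ifs with h <;> simp [h]

theorem length_dirtyList_le (n l : ℕ) (inp : ℕ → ℕ) (k : ℕ) :
    (dirtyList n l inp k).length ≤ k := by
  refine (List.length_filter_le _ _).trans ?_
  simp

theorem wp_findDirty {n l M B : ℕ} {inp : ℕ → ℕ} (hM : M = n * l)
    (hB : 4 * M + 10 * n + 10 * l + 200 ≤ B) (σ : St) (T : ℤ) (hσ : Consts n l M σ)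
    (hP : HasPrev n l inp (σ.A .prev)) (hT : 30 * l + 10 ≤ T) (Q : St → ℤ → Prop)
    (hQ : ∀ σ' T', Consts n l M σ' →
      (List.range (σ'.r .dirties)).map (σ'.A .dirty) = dirtyList n l inp l →
      (∀ a, a ≠ .dirty → ∀ q, σ'.A a q = σ.A a q) → T - 30 * l - 10 ≤ T' → Q σ' T') :
    wp B M inp findDirty Q σ T := by
  classical
  obtain ⟨c1, c2, c3, c4, c5⟩ := hσ
  simp only [findDirty, wp]
  refine ⟨by omega, by omega, fun σ' T' => Consts n l M σ' ∧ σ'.r .col ≤ l ∧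
    (List.range (σ'.r .dirties)).map (σ'.A .dirty) = dirtyList n l inp (σ'.r .col) ∧
    (∀ a, a ≠ .dirty → ∀ q, σ'.A a q = σ.A a q) ∧
    T - 30 * l - 9 + 30 * (l - σ'.r .col) ≤ T', ?_, ?_⟩
  · refine ⟨by simp [Consts, *], by simp, by simp [dirtyList], by simp, by simp; omega⟩
  · rintro τ S ⟨⟨d1, d2, d3, d4, d5⟩, hp, hL, hA, hS⟩
    refine ⟨by omega, fun hb => ?_, fun hb => ?_⟩
    · simp only [Cond.holds_lt] at hb
      have hlen := congrArg List.length hL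
      have hle := length_dirtyList_le n l inp (τ.r .col)
      simp only [List.length_map, List.length_range] at hlen
      have hv : ∀ a < 2, τ.A .prev (M + τ.r .col + (M + τ.r .col) + a) =
          prevRow (fun i j => inp (i * l + j)) (τ.r .col) a n := by
        intro a ha
        rw [hA _ (by simp), ← hP n le_rfl _ (by omega) a ha]
        congr 1
        rw [← hM]; ring
      have hd : IsDirty n l inp (τ.r .col) ↔
          0 < prevRow (fun i j => inp (i * l + j)) (τ.r .col) 0 n ∧
          0 < prevRow (fun i j => inp (i * l + j)) (τ.r .col) 1 n := by
        rw [prevRow_pos_iff, prevRow_pos_iff, IsDirty]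
      have hv0 := hv 0 (by omega)
      have hv1 := hv 1 (by omega)
      simp only [add_zero] at hv0
      simp only [St.setr_r, St.setr_A, St.seta_r, St.seta_A, Cond.holds_lt, reduceCtorEq, if_true,
        if_false, d1, d2, d3, d4, d5, hv0, hv1, Consts, and_self, true_and]
      refine ⟨by omega, by omega, by omega,
        fun h0 => ⟨fun h1 => ⟨by omega, by omega, by omega, ?_, ?_, by omega⟩,
          fun h1 => ⟨by omega, by omega, ?_, hA, by omega⟩⟩,
        fun h0 => ⟨by omega, by omega, ?_, hA, by omega⟩⟩
      · rw [dirtyList_succ, if_pos (hd.2 ⟨h0, h1⟩), List.range_succ, List.map_append, ← hL]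
        congr 1
        · refine List.map_congr_left fun q hq => ?_
          have := List.mem_range.1 hq
          simp [this.ne]
        · simp
      · intro a ha q
        simp [ha, hA a ha q]
      · rw [dirtyList_succ, if_neg (fun h => h1 (hd.1 h).2), ← hL]
      · rw [dirtyList_succ, if_neg (fun h => h0 (hd.1 h).1), ← hL]
    · simp only [Cond.holds_lt] at hb
      have : τ.r .col = l := by omega
      exact hQ _ _ ⟨d1, d2, d3, d4, d5⟩ (this ▸ hL) hA (by omega)

/-- The entry of a row (with first cell `base`) in the `k`-th of the columns `D 0, …, D (d - 1)`;
missing if `k ≥ d`. -/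
def digitVal (d : ℕ) (D inp : ℕ → ℕ) (base k : ℕ) : ℕ := if k < d then inp (D k + base) else 2

/-- The entries of a row in up to four columns, written in base `3`. -/
def rowType (d : ℕ) (D inp : ℕ → ℕ) (base : ℕ) : ℕ :=
  ((digitVal d D inp base 0 * 3 + digitVal d D inp base 1) * 3 + digitVal d D inp base 2) * 3 +
    digitVal d D inp base 3

theorem digitVal_le {M : ℕ} {inp : ℕ → ℕ} (hinp : ∀ q < M, inp q ≤ 2) {d : ℕ} {D : ℕ → ℕ}
    {base k : ℕ} (h : k < d → D k + base < M) : digitVal d D inp base k ≤ 2 := by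
  unfold digitVal
  split_ifs with hk
  exacts [hinp _ (h hk), le_rfl]

/-- Append a digit to the number in register `tmpC`. -/
def appendDigit (k : ℕ) : Cmd :=
  .set .tmpA k ;;
  .ite (.lt .tmpA .dirties) (.load .tmpB .dirty .tmpA ;; .add .tmpB .tmpB .pos ;;
    .read .entry .tmpB ;; .set .tmpA 3 ;; .mul .tmpC .tmpC .tmpA ;; .add .tmpC .tmpC .entry)
    (.set .entry 2 ;; .set .tmpA 3 ;; .mul .tmpC .tmpC .tmpA ;; .add .tmpC .tmpC .entry)

/-- The bound 26 is the largest number with three ternary digits, the most that can precede a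
fourth. -/
theorem wp_appendDigit {M B : ℕ} {inp : ℕ → ℕ} (hinp : ∀ q < M, inp q ≤ 2) (hB : M + 200 ≤ B)
    (k : ℕ) (hk : k < 4) (σ : St) (T : ℤ)
    (hD : k < σ.r .dirties → σ.A .dirty k + σ.r .pos < M) (hC : σ.r .tmpC ≤ 26)
    (Q : St → ℤ → Prop)
    (hQ : ∀ σ' T', σ'.A = σ.A → (∀ y, y ≠ .tmpA → y ≠ .tmpB → y ≠ .tmpC → y ≠ .entry →
      σ'.r y = σ.r y) → σ'.r .tmpC = σ.r .tmpC * 3 +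
        digitVal (σ.r .dirties) (σ.A .dirty) inp (σ.r .pos) k → T - 20 ≤ T' → Q σ' T') :
    wp B M inp (appendDigit k) Q σ T := by
  simp only [appendDigit, wp, St.setr_r, St.setr_A, Cond.holds_lt, reduceCtorEq, if_true, if_false]
  refine ⟨by omega, fun h => ?_, fun h => ?_⟩
  · have h1 := hD h
    have h2 := hinp _ h1
    refine ⟨by omega, h1, by omega, by omega, by omega, hQ _ _ rfl ?_ ?_ (by omega)⟩
    · intro y h1 h2 h3 h4
      simp [h1, h2, h3, h4]
    · simp [digitVal, h]
  · refine ⟨by omega, by omega, by omega, by omega, hQ _ _ rfl ?_ ?_ (by omega)⟩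
    · intro y h1 _ h3 h4
      simp [h1, h3, h4]
    · simp [digitVal, h]

/-- Mark the types of all rows in the array `mark`. -/
def markTypes : Cmd :=
  .set .row 0 ;; .set .pos 0 ;;
  .loop (.lt .row .rows)
    (.set .tmpC 0 ;; appendDigit 0 ;; appendDigit 1 ;; appendDigit 2 ;; appendDigit 3 ;;
      .store .mark .tmpC .one ;; .add .row .row .one ;; .add .pos .pos .cols)

theorem wp_markTypes {n l M B : ℕ} {inp : ℕ → ℕ} (hM : M = n * l)
    (hinp : ∀ q < M, inp q ≤ 2) (hB : 4 * M + 10 * n + 10 * l + 200 ≤ B) (σ : St) (T : ℤ)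
    (hσ : Consts n l M σ) (hD : ∀ k < σ.r .dirties, σ.A .dirty k < l)
    (h0 : ∀ q, σ.A .mark q = 0) (hT : 120 * n + 10 ≤ T) (Q : St → ℤ → Prop)
    (hQ : ∀ σ' T', Consts n l M σ' → (∀ q, σ'.A .mark q = 1 ↔ ∃ i < n,
      rowType (σ.r .dirties) (σ.A .dirty) inp (i * l) = q) → T - 120 * n - 10 ≤ T' → Q σ' T') :
    wp B M inp markTypes Q σ T := by
  obtain ⟨c1, c2, c3, c4, c5⟩ := hσ
  simp only [markTypes, wp]
  refine ⟨by omega, by omega, fun σ' T' => Consts n l M σ' ∧ σ'.r .row ≤ n ∧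
    σ'.r .pos = σ'.r .row * l ∧ σ'.r .dirties = σ.r .dirties ∧ σ'.A .dirty = σ.A .dirty ∧
    (∀ q, σ'.A .mark q = 1 ↔ ∃ i < σ'.r .row,
      rowType (σ.r .dirties) (σ.A .dirty) inp (i * l) = q) ∧
    T - 120 * n - 9 + 120 * (n - σ'.r .row) ≤ T', ?_, ?_⟩
  · refine ⟨by simp [Consts, *], by simp, by simp, by simp, by simp, by simp [h0],
      by simp; omega⟩
  · rintro τ S ⟨⟨d1, d2, d3, d4, d5⟩, hr, hp, hd, hdA, hmk, hS⟩
    refine ⟨by omega, fun hb => ?_, fun hb => ?_⟩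
    · simp only [Cond.holds_lt] at hb
      have hrow : τ.r .row * l + l ≤ M := by
        rw [hM, ← Nat.succ_mul]; exact Nat.mul_le_mul_right l (by omega)
      have hcell : ∀ k < σ.r .dirties, σ.A .dirty k + τ.r .pos < M := fun k hk => by
        have := hD k hk; omega
      have hdg : ∀ k, digitVal (σ.r .dirties) (σ.A .dirty) inp (τ.r .pos) k ≤ 2 :=
        fun k => digitVal_le hinp (hcell k)
      have g0 := hdg 0
      have g1 := hdg 1
      have g2 := hdg 2
      have g3 := hdg 3
      refine ⟨by omega, ?_⟩
      refine wp_appendDigit hinp (by omega) 0 (by omega) _ _ ?_ (by simp) _ ?_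
      · simpa [hd, hdA] using hcell 0
      intro τ1 S1 eA1 er1 et1 hS1
      simp only [St.setr_A, St.setr_r, reduceCtorEq, if_true, if_false] at eA1 er1 et1
      have p1 : τ1.r .pos = τ.r .pos := by rw [er1] <;> simp
      have n1 : τ1.r .dirties = σ.r .dirties := by rw [er1] <;> simp [hd]
      rw [hd, hdA] at et1
      refine wp_appendDigit hinp (by omega) 1 (by omega) _ _ ?_ (by omega) _ ?_
      · simpa [eA1, n1, p1, hdA] using hcell 1
      intro τ2 S2 eA2 er2 et2 hS2
      have p2 : τ2.r .pos = τ.r .pos := by rw [er2, p1] <;> simp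
      have n2 : τ2.r .dirties = σ.r .dirties := by rw [er2, n1] <;> simp
      rw [eA1] at eA2
      rw [eA1, n1, p1, hdA] at et2
      refine wp_appendDigit hinp (by omega) 2 (by omega) _ _ ?_ (by omega) _ ?_
      · simpa [eA2, n2, p2, hdA] using hcell 2
      intro τ3 S3 eA3 er3 et3 hS3
      have p3 : τ3.r .pos = τ.r .pos := by rw [er3, p2] <;> simp
      have n3 : τ3.r .dirties = σ.r .dirties := by rw [er3, n2] <;> simp
      rw [eA2] at eA3
      rw [eA2, n2, p2, hdA] at et3
      refine wp_appendDigit hinp (by omega) 3 (by omega) _ _ ?_ (by omega) _ ?_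
      · simpa [eA3, n3, p3, hdA] using hcell 3
      intro τ4 S4 eA4 er4 et4 hS4
      have p4 : τ4.r .pos = τ.r .pos := by rw [er4, p3] <;> simp
      have n4 : τ4.r .dirties = σ.r .dirties := by rw [er4, n3] <;> simp
      rw [eA3] at eA4
      rw [eA3, n3, p3, hdA] at et4
      have er : ∀ y, y ≠ .tmpA → y ≠ .tmpB → y ≠ .tmpC → y ≠ .entry → τ4.r y = τ.r y := by
        intro y h1 h2 h3 h4
        rw [er4 y h1 h2 h3 h4, er3 y h1 h2 h3 h4, er2 y h1 h2 h3 h4, er1 y h1 h2 h3 h4, if_neg h3]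
      have et : τ4.r .tmpC = rowType (σ.r .dirties) (σ.A .dirty) inp (τ.r .row * l) := by
        rw [et4, et3, et2, et1, hp, zero_mul, zero_add, rowType]
      simp only [St.setr_r, St.setr_A, St.seta_r, St.seta_A, reduceCtorEq, if_true, if_false,
        Consts, er _, ne_eq, not_false_eq_true, eA4, d1, d2, d3, d4, d5, and_self, true_and]
      refine ⟨by omega, by omega, by omega, ?_, hd, ?_, ?_, by omega⟩
      · rw [hp]; ring
      · funext q
        simp [eA4, hdA]
      · intro q
        rw [et]
        split_ifs with h
        · subst h
          simp only [true_iff]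
          exact ⟨_, Nat.lt_succ_self _, rfl⟩
        · rw [hmk]
          constructor
          · rintro ⟨i, hi, e⟩
            exact ⟨i, by omega, e⟩
          · rintro ⟨i, hi, e⟩
            refine ⟨i, ?_, e⟩
            rcases Nat.lt_succ_iff_lt_or_eq.1 hi with h' | rfl
            · exact h'
            · exact absurd e.symm h
    · simp only [Cond.holds_lt] at hb
      have : τ.r .row = n := by omega
      exact hQ _ _ ⟨d1, d2, d3, d4, d5⟩ (this ▸ hmk) (by omega)

open Classical in
/-- A decision tree that evaluates a property of the set of marked numbers below `k`, given the
set `m` of larger ones. -/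
noncomputable def decisionTree (R : (ℕ → Prop) → Prop) : ℕ → (ℕ → Prop) → Cmd
  | 0, m => if R m then .set .ans 1 else .set .ans 0
  | k + 1, m => .set .tmpA k ;; .load .tmpB .mark .tmpA ;;
      .ite (.eq .tmpB .one) (decisionTree R k fun q => q = k ∨ m q) (decisionTree R k m)

/-- The tree is one fixed finite program: its leaves are chosen classically, but independently of
the input. `m` records the marks already read on the path, from the largest number downwards. -/
theorem wp_decisionTree {M B : ℕ} {inp : ℕ → ℕ} (R : (ℕ → Prop) → Prop) (k : ℕ) (hk : k ≤ B)
    (hB : 1 ≤ B) (Q : St → ℤ → Prop) (m : ℕ → Prop) (σ : St) (T : ℤ) (h1 : σ.r .one = 1)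
    (hQ : ∀ σ' T', (R (fun q => (q < k ∧ σ.A .mark q = 1) ∨ m q) → σ'.r .ans = 1) →
      (¬ R (fun q => (q < k ∧ σ.A .mark q = 1) ∨ m q) → σ'.r .ans = 0) →
      T - 10 * k - 1 ≤ T' → Q σ' T') :
    wp B M inp (decisionTree R k m) Q σ T := by
  induction k generalizing m σ T with
  | zero =>
    simp only [not_lt_zero, false_and, false_or] at hQ
    unfold decisionTree
    split_ifs with h
    · exact ⟨hB, hQ _ _ (fun _ => by simp) (fun h' => absurd h h') (by simp)⟩
    · exact ⟨by omega, hQ _ _ (fun h' => absurd h' h) (fun _ => by simp) (by simp)⟩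
  | succ k ih =>
    simp only [decisionTree, wp, St.setr_r, St.setr_A, Cond.holds_eq, reduceCtorEq, if_true,
      if_false, h1]
    refine ⟨by omega, fun h => ?_, fun h => ?_⟩
    · refine ih (by omega) _ _ _ (by simp [h1]) ?_
      intro σ' T' e1 e2 e3
      have e : (fun q => (q < k + 1 ∧ σ.A .mark q = 1) ∨ m q) =
          fun q => (q < k ∧ σ.A .mark q = 1) ∨ q = k ∨ m q := by
        funext q
        by_cases hq : q = k
        · simp [hq, h]
        · have : q < k + 1 ↔ q < k := by omega
          simp [hq, this]
      simp only [St.setr_A] at e1 e2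
      refine hQ σ' T' ?_ ?_ (by push_cast; omega)
      · rwa [e]
      · rwa [e]
    · refine ih (by omega) _ _ _ (by simp [h1]) ?_
      intro σ' T' e1 e2 e3
      have e : (fun q => (q < k + 1 ∧ σ.A .mark q = 1) ∨ m q) =
          fun q => (q < k ∧ σ.A .mark q = 1) ∨ m q := by
        funext q
        by_cases hq : q = k
        · simp [hq, h]
        · have : q < k + 1 ↔ q < k := by omega
          simp [this]
      simp only [St.setr_A] at e1 e2
      refine hQ σ' T' ?_ ?_ (by push_cast; omega)
      · rwa [e]
      · rwa [e]

/-! ### The encoded input, and completability by row types -/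

theorem input_mem {n l : ℕ} (S : IncMatrix n l) (i : Fin n) (j : Fin l) :
    (input S).mem (i * l + j) = code (S i j) := by
  have h1 : (i : ℕ) * l + l ≤ n * l := by
    rw [← Nat.succ_mul]; exact Nat.mul_le_mul_right l i.2
  have h : (i : ℕ) * l + j < n * l := by omega
  have e : (⟨(i : ℕ) * l + j, h⟩ : Fin (n * l)) = finProdFinEquiv (i, j) := by
    ext; simp [finProdFinEquiv, add_comm, mul_comm]
  simp only [input, h, dif_pos, e, Equiv.symm_apply_apply]

theorem input_mem_le {n l : ℕ} (S : IncMatrix n l) (q : ℕ) : (input S).mem q ≤ 2 := by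
  simp only [input]
  split_ifs with h
  · generalize S _ _ = o
    rcases o with _ | _ | _ <;> simp [code]
  · omega

theorem code_eq_zero {o : Option Bool} : code o = 0 ↔ o = some false := by
  rcases o with _ | _ | _ <;> simp [code]

theorem code_eq_one {o : Option Bool} : code o = 1 ↔ o = some true := by
  rcases o with _ | _ | _ <;> simp [code]

theorem code_eq_two {o : Option Bool} : code o = 2 ↔ o = none := by
  rcases o with _ | _ | _ <;> simp [code]

theorem code_eq_toNat {o : Option Bool} {b : Bool} : code o = b.toNat ↔ o = some b := by
  rcases o with _ | _ | _ <;> cases b <;> simp [code]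

theorem isDirty_input {n l : ℕ} (S : IncMatrix n l) (j : Fin l) :
    IsDirty n l (input S).mem j ↔ j ∈ dirtyCols S := by
  simp only [IsDirty, dirtyCols, Finset.mem_filter, Finset.mem_univ, true_and]
  refine and_congr ⟨?_, ?_⟩ ⟨?_, ?_⟩
  · rintro ⟨i, hi, h⟩
    exact ⟨⟨i, hi⟩, code_eq_zero.1 ((input_mem S ⟨i, hi⟩ j).symm.trans h)⟩
  · rintro ⟨i, h⟩
    exact ⟨i, i.2, by rw [input_mem, h]; rfl⟩
  · rintro ⟨i, hi, h⟩
    exact ⟨⟨i, hi⟩, code_eq_one.1 ((input_mem S ⟨i, hi⟩ j).symm.trans h)⟩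
  · rintro ⟨i, h⟩
    exact ⟨i, i.2, by rw [input_mem, h]; rfl⟩

theorem mem_dirtyList {n l : ℕ} {inp : ℕ → ℕ} {k j : ℕ} :
    j ∈ dirtyList n l inp k ↔ j < k ∧ IsDirty n l inp j := by
  simp [dirtyList]

theorem nodup_dirtyList (n l : ℕ) (inp : ℕ → ℕ) (k : ℕ) : (dirtyList n l inp k).Nodup :=
  List.nodup_range.filter _

theorem length_dirtyList {n l : ℕ} (S : IncMatrix n l) :
    (dirtyList n l (input S).mem l).length = (dirtyCols S).card := by
  rw [← List.toFinset_card_of_nodup (nodup_dirtyList _ _ _ _),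
    ← Finset.card_map Fin.valEmbedding]
  congr 1
  ext j
  simp only [List.mem_toFinset, mem_dirtyList, Finset.mem_map, Fin.valEmbedding_apply]
  constructor
  · rintro ⟨hj, h⟩
    exact ⟨⟨j, hj⟩, (isDirty_input S ⟨j, hj⟩).1 h, rfl⟩
  · rintro ⟨j, h, rfl⟩
    exact ⟨j.2, (isDirty_input S j).2 h⟩

/-- Rows of the marked types have completions with pairwise distances at most two. -/
def TypesCompletable (m : ℕ → Prop) : Prop :=
  ∃ g : ℕ → Fin 4 → Bool,
    (∀ q, m q → ∀ k : Fin 4, q / 3 ^ (3 - k.1) % 3 = 2 ∨ q / 3 ^ (3 - k.1) % 3 = (g q k).toNat) ∧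
    ∀ q q', m q → m q' → (Finset.univ.filter fun k => g q k ≠ g q' k).card ≤ 2

theorem digit_rowType (d : ℕ) (D inp : ℕ → ℕ) (base : ℕ)
    (h : ∀ k, digitVal d D inp base k ≤ 2) (k : Fin 4) :
    rowType d D inp base / 3 ^ (3 - k.1) % 3 = digitVal d D inp base k := by
  have h0 := h 0
  have h1 := h 1
  have h2 := h 2
  have h3 := h 3
  unfold rowType
  fin_cases k <;> simp <;> omega

theorem rowType_lt (d : ℕ) (D inp : ℕ → ℕ) (base : ℕ)
    (h : ∀ k, digitVal d D inp base k ≤ 2) : rowType d D inp base < 81 := by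
  have h0 := h 0
  have h1 := h 1
  have h2 := h 2
  have h3 := h 3
  unfold rowType
  omega

/-- Giving every row the completion of one representative of its type creates no new pair of
completed rows, and columns that are not dirty can be completed to constant ones. -/
theorem DMC_iff_typesCompletable {n l : ℕ} (S : IncMatrix n l) (d : ℕ) (D : ℕ → ℕ) (hd : d ≤ 4)
    (hD : (List.range d).map D = dirtyList n l (input S).mem l) :
    DMC 0 2 n l S ↔ TypesCompletable fun q => ∃ i < n, rowType d D (input S).mem (i * l) = q := by
  have hDl : ∀ k < d, D k < l := fun k hk => by
    have : D k ∈ dirtyList n l (input S).mem l := hD ▸ List.mem_map_of_mem (List.mem_range.2 hk)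
    exact (mem_dirtyList.1 this).1
  have hinj : ∀ k < d, ∀ k' < d, D k = D k' → k = k' := by
    have := nodup_dirtyList n l (input S).mem l
    rw [← hD] at this
    intro k hk k' hk' e
    exact List.inj_on_of_nodup_map this (List.mem_range.2 hk) (List.mem_range.2 hk') e
  have hsurj : ∀ j ∈ dirtyCols S, ∃ k < d, D k = j := by
    intro j hj
    have : (j : ℕ) ∈ (List.range d).map D :=
      hD ▸ mem_dirtyList.2 ⟨j.2, (isDirty_input S j).2 hj⟩
    simpa using this
  have hdig : ∀ base k, digitVal d D (input S).mem base k ≤ 2 := by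
    intro base k
    unfold digitVal
    split_ifs
    exacts [input_mem_le S _, le_rfl]
  have hval : ∀ (i : Fin n) (k : Fin 4) (hk : (k : ℕ) < d),
      rowType d D (input S).mem (i * l) / 3 ^ (3 - k.1) % 3 = code (S i ⟨D k, hDl k hk⟩) := by
    intro i k hk
    rw [digit_rowType _ _ _ _ (hdig _), digitVal, if_pos hk, add_comm, ← input_mem]
  have hval' : ∀ (i : Fin n) (k : Fin 4), ¬ (k : ℕ) < d →
      rowType d D (input S).mem (i * l) / 3 ^ (3 - k.1) % 3 = 2 := by
    intro i k hk
    rw [digit_rowType _ _ _ _ (hdig _), digitVal, if_neg hk]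
  rw [DMC_zero_iff]
  constructor
  · rintro ⟨T, hT, hdist⟩
    -- One row represents each occurring type. Positions from `d` on are padding and get `false`
    -- everywhere, so they contribute no difference.
    have hrep : ∀ q, ∃ f : Fin 4 → Bool, (∃ i < n, rowType d D (input S).mem (i * l) = q) →
        ∃ i : Fin n, rowType d D (input S).mem (i * l) = q ∧
          ∀ k : Fin 4, f k = if hk : (k : ℕ) < d then T i ⟨D k, hDl k hk⟩ else false := by
      intro q
      by_cases h : ∃ i < n, rowType d D (input S).mem (i * l) = q
      · obtain ⟨i, hi, e⟩ := h
        exact ⟨_, fun _ => ⟨⟨i, hi⟩, e, fun k => rfl⟩⟩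
      · exact ⟨fun _ => false, fun h' => absurd h' h⟩
    choose g hg using hrep
    refine ⟨g, fun q hq k => ?_, fun q q' hq hq' => ?_⟩
    · obtain ⟨i, rfl, hf⟩ := hg q hq
      by_cases hk : (k : ℕ) < d
      · rw [hval i k hk, hf k, dif_pos hk, code_eq_two, code_eq_toNat]
        exact hT i _
      · exact Or.inl (hval' i k hk)
    · obtain ⟨i, -, hf⟩ := hg q hq
      obtain ⟨i', -, hf'⟩ := hg q' hq'
      refine le_trans ?_ (hdist i i')
      have hlt : ∀ k ∈ Finset.univ.filter (fun k => g q k ≠ g q' k), (k : ℕ) < d := by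
        intro k hk
        by_contra h
        simp [hf k, hf' k, h] at hk
      rcases Finset.eq_empty_or_nonempty (Finset.univ.filter fun k => g q k ≠ g q' k) with
        h0 | ⟨k₀, hk₀⟩
      · simp [h0]
      have hd0 : 0 < d := by have := hlt k₀ hk₀; omega
      -- Positions in the difference set lie below `d`; `D 0` is only a default value elsewhere.
      refine Finset.card_le_card_of_injOn
        (fun k => if hk : (k : ℕ) < d then ⟨D k, hDl k hk⟩ else ⟨D 0, hDl 0 hd0⟩) ?_ ?_
      · intro k hk
        have h := hlt k hk
        simp only [Finset.coe_filter, Finset.mem_univ, true_and, Set.mem_ofPred_eq, hf k, hf' k,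
          dif_pos h] at hk ⊢
        exact hk
      · intro k hk k' hk' e
        simp only [dif_pos (hlt k hk), dif_pos (hlt k' hk'), Fin.mk.injEq] at e
        exact Fin.ext (hinj k (hlt k hk) k' (hlt k' hk') e)
  · rintro ⟨g, hg, hdist⟩
    classical
    let ty : Fin n → ℕ := fun i => rowType d D (input S).mem (i * l)
    have hty : ∀ i, ∃ i' < n, rowType d D (input S).mem (i' * l) = ty i := fun i => ⟨i, i.2, rfl⟩
    -- A column that is not dirty shows at most one value; it is filled with that value, or with `0`
    -- if it has no entry, equally in all rows.
    refine ⟨fun i j => if h : ∃ k : Fin 4, (k : ℕ) < d ∧ D k = j then g (ty i) h.choose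
      else decide (∃ i, S i j = some true), fun i j => ?_, fun i i' => ?_⟩
    · beta_reduce
      split_ifs with h
      · obtain ⟨h1, h2⟩ := h.choose_spec
        have := hg _ (hty i) h.choose
        rw [hval i _ h1, code_eq_two, code_eq_toNat] at this
        have e : (⟨D h.choose, hDl _ h1⟩ : Fin l) = j := Fin.ext h2
        rwa [e] at this
      · have hj : j ∉ dirtyCols S := by
          intro hj
          obtain ⟨k, hk, e⟩ := hsurj j hj
          exact h ⟨⟨k, by omega⟩, hk, e⟩
        rcases ho : S i j with _ | _ | _
        · exact Or.inl rfl
        · right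
          congr 1
          symm
          rw [decide_eq_false_iff_not]
          intro h'
          exact hj (Finset.mem_filter.2 ⟨Finset.mem_univ _, ⟨i, ho⟩, h'⟩)
        · right
          congr 1
          symm
          rw [decide_eq_true_iff]
          exact ⟨i, ho⟩
    · refine le_trans ?_ (hdist _ _ (hty i) (hty i'))
      have hex : ∀ j : Fin l, j ∈ Finset.univ.filter (fun j : Fin l =>
          (if h : ∃ k : Fin 4, (k : ℕ) < d ∧ D k = j then g (ty i) h.choose
            else decide (∃ i, S i j = some true)) ≠
          (if h : ∃ k : Fin 4, (k : ℕ) < d ∧ D k = j then g (ty i') h.choose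
            else decide (∃ i, S i j = some true))) →
          ∃ k : Fin 4, D k = j ∧ g (ty i) k ≠ g (ty i') k := by
        intro j hj
        by_cases h : ∃ k : Fin 4, (k : ℕ) < d ∧ D k = j
        · simp only [Finset.mem_filter, Finset.mem_univ, true_and, dif_pos h] at hj
          exact ⟨h.choose, h.choose_spec.2, hj⟩
        · simp [h] at hj
      choose! f hf using hex
      refine Finset.card_le_card_of_injOn f ?_ ?_
      · intro j hj
        simpa using (hf j hj).2
      · intro j hj j' hj' e
        exact Fin.ext ((hf j hj).1.symm.trans
          ((congrArg (fun k : Fin 4 => D k) e).trans (hf j' hj').1))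

/-! ### Centres of radius one and partial solutions -/

/-- Row `i` disagrees with the assignment `w` in column `j`. -/
def Mismatch (l : ℕ) (inp w : ℕ → ℕ) (i j : ℕ) : Prop :=
  inp (i * l + j) ≠ 2 ∧ inp (i * l + j) ≠ w j

/-- The binary assignment `w` disagrees with each row in at most one of the first `k` columns. -/
def Good (n l : ℕ) (inp : ℕ → ℕ) (k : ℕ) (w : ℕ → ℕ) : Prop :=
  (∀ j, w j < 2) ∧ ∀ i < n, ∀ j < k, ∀ j' < k, Mismatch l inp w i j → Mismatch l inp w i j' → j = j'

theorem conRMC_one_iff {n l : ℕ} (S : IncMatrix n l) :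
    ConRMC S (fun _ => 1) ↔ ∃ w, Good n l (input S).mem l w := by
  have key : ∀ (w : ℕ → ℕ) (v : Fin l → Bool) (_ : ∀ j : Fin l, w j = (v j).toNat)
      (i : Fin n) (j : Fin l), Mismatch l (input S).mem w i j ↔ j ∈ diffSet (toInc v) (S i) := by
    intro w v hv i j
    rw [diffSet, Finset.mem_filter]
    simp only [Mismatch, input_mem, hv, Ne, code_eq_two, code_eq_toNat, toInc, Finset.mem_univ,
      true_and]
    rcases S i j with _ | _ | _ <;> cases v j <;> simp
  constructor
  · rintro ⟨v, hv⟩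
    let w : ℕ → ℕ := fun j => if h : j < l then (v ⟨j, h⟩).toNat else 0
    have hw : ∀ j : Fin l, w j = (v j).toNat := fun j => by simp [w]
    refine ⟨w, fun j => ?_, fun i hi j hj j' hj' h h' => ?_⟩
    · simp only [w]
      split_ifs
      · exact Bool.toNat_lt _
      · omega
    · have := Finset.card_le_one.1 (hv ⟨i, hi⟩) ⟨j, hj⟩ ((key w v hw ⟨i, hi⟩ ⟨j, hj⟩).1 h)
        ⟨j', hj'⟩ ((key w v hw ⟨i, hi⟩ ⟨j', hj'⟩).1 h')
      exact congrArg Fin.val this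
  · rintro ⟨w, hw2, hw⟩
    have hw' : ∀ j : Fin l, w j = (decide (w j = 1)).toNat := fun j => by
      have := hw2 j
      by_cases h : w j = 1
      · simp [h]
      · simp [h]; omega
    refine ⟨fun j => decide (w j = 1), fun i => Finset.card_le_one.2 fun j hj j' hj' => ?_⟩
    exact Fin.ext (hw i i.2 j j.2 j' j'.2 ((key w _ hw' i j).2 hj) ((key w _ hw' i j').2 hj'))

/-- `V` disagrees with row `i` in at most one of the first `j` columns, namely in column `K i`; if
there is no such column, then `K i = l`. -/
structure Tracks (n l : ℕ) (inp : ℕ → ℕ) (j : ℕ) (V K : ℕ → ℕ) : Prop where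
  lt_two : ∀ c, V c < 2
  mismatch_iff : ∀ i < n, ∀ c < j, (Mismatch l inp V i c ↔ K i = c)
  range : ∀ i < n, K i < j ∨ K i = l

theorem Tracks.good {n l j : ℕ} {inp V K : ℕ → ℕ} (h : Tracks n l inp j V K) :
    Good n l inp j V :=
  ⟨h.lt_two, fun i hi c hc c' hc' hm hm' =>
    ((h.mismatch_iff i hi c hc).1 hm).symm.trans ((h.mismatch_iff i hi c' hc').1 hm')⟩

/-- Only the columns before `j` are inspected, so column `j` can be preset before a trial. -/
theorem Tracks.update {n l j : ℕ} {inp V K : ℕ → ℕ} (h : Tracks n l inp j V K) {b : ℕ}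
    (hb : b < 2) : Tracks n l inp j (Function.update V j b) K where
  lt_two c := by
    rw [Function.update_apply]
    split_ifs
    exacts [hb, h.lt_two c]
  mismatch_iff i hi c hc := by
    rw [← h.mismatch_iff i hi c hc, Mismatch, Function.update_of_ne hc.ne, Mismatch]
  range := h.range

theorem Good.mono {n l k k' : ℕ} {inp w : ℕ → ℕ} (h : Good n l inp k' w) (hk : k ≤ k') :
    Good n l inp k w :=
  ⟨h.1, fun i hi c hc c' hc' => h.2 i hi c (hc.trans_le hk) c' (hc'.trans_le hk)⟩

/-! ### Propagation of forced flips -/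

/-- The state of the propagation that sets column `j` to `a`. The columns with `F c = g` have to be
flipped, they are queued in `L 0, …, L (t - 1)`; the rows that newly disagree with column `L k`,
`k < h`, and those from `x` on that newly disagree with column `L h`, have `N i = g`, and `C i` is
that column. -/
structure Propagation (n l : ℕ) (inp V K : ℕ → ℕ) (j a g : ℕ) (F N C L : ℕ → ℕ)
    (t h x : ℕ) : Prop where
  flip_le : ∀ c, F c ≤ g
  stamp_le : ∀ i, N i ≤ g
  start : F j = g
  queue_le : ∀ k < t, L k ≤ j
  flip_queue : ∀ k < t, F (L k) = g
  mem_queue : ∀ c, F c = g → ∃ k < t, L k = c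
  queue_inj : ∀ k < t, ∀ k' < t, L k = L k' → k = k'
  cause : ∀ i < n, N i = g → F (C i) = g ∧ inp (i * l + C i) = V (C i) ∧ (K i < l → F (K i) = g)
  forced : ∀ w, Good n l inp (j + 1) w → w j = a → ∀ c, F c = g → w c ≠ V c
  processed : ∀ k < h, ∀ i < n, inp (i * l + L k) = V (L k) → N i = g ∧ C i = L k
  current : ∀ i < n, x ≤ i → inp (i * l + L h) = V (L h) → N i = g ∧ C i = L h
  stamped : ∀ i < n, N i = g → (∃ k < h, C i = L k) ∨ (C i = L h ∧ x ≤ i)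

section
variable {n l : ℕ} {inp V K : ℕ → ℕ} {j a g : ℕ} {F N C L : ℕ → ℕ} {t h x : ℕ}

/-- All old time stamps are below `g`, so nothing counts as flipped or stamped and no array has to
be cleared. Column `j` holds the value other than `a`, so that flipping it produces `a`. Taking `x =
n` says that no row has been scanned. -/
theorem Propagation.init (hF : ∀ c, F c < g) (hN : ∀ i, N i < g) (hV : V j ≠ a) :
    Propagation n l inp V K j a g (Function.update F j g) N C (Function.update L 0 j) 1 0 n where
  flip_le c := by
    rw [Function.update_apply]
    split_ifs
    exacts [le_rfl, (hF c).le]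
  stamp_le i := (hN i).le
  start := by simp
  queue_le k hk := by simp [Nat.lt_one_iff.1 hk]
  flip_queue k hk := by simp [Nat.lt_one_iff.1 hk]
  mem_queue c hc := by
    by_cases h : c = j
    · exact ⟨0, by simp, by simp [h]⟩
    · rw [Function.update_of_ne h] at hc
      exact absurd hc (hF c).ne
  queue_inj k hk k' hk' _ := by omega
  cause i _ h := absurd h (hN i).ne
  forced w _ hw c hc := by
    by_cases h : c = j
    · subst h
      rw [hw]
      exact hV.symm
    · rw [Function.update_of_ne h] at hc
      exact absurd hc (hF c).ne
  processed k hk := by omega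
  current i hi hx := by omega
  stamped i _ h := absurd h (hN i).ne

/-- The scan descends through the rows; rows jumped over by a link do not newly disagree with the
current column. -/
theorem Propagation.lower (P : Propagation n l inp V K j a g F N C L t h x) {x' : ℕ}
    (hx : x' ≤ x) (hne : ∀ i, x' ≤ i → i < x → inp (i * l + L h) ≠ V (L h)) :
    Propagation n l inp V K j a g F N C L t h x' :=
  { P with
    current := fun i hi hxi he => P.current i hi (by
      by_contra hc
      exact hne i hxi (by omega) he) he
    stamped := fun i hi hs => (P.stamped i hi hs).imp_right fun ⟨h1, h2⟩ => ⟨h1, by omega⟩ }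

theorem Propagation.finish (P : Propagation n l inp V K j a g F N C L t h 0) :
    Propagation n l inp V K j a g F N C L t (h + 1) n :=
  { P with
    processed := fun k hk i hi he => by
      rcases Nat.lt_succ_iff_lt_or_eq.1 hk with hk | rfl
      · exact P.processed k hk i hi he
      · exact P.current i hi (Nat.zero_le _) he
    current := fun i hi hx => by omega
    stamped := fun i hi hs => Or.inl (by
      rcases P.stamped i hi hs with ⟨k, hk, e⟩ | ⟨e, -⟩
      · exact ⟨k, by omega, e⟩
      · exact ⟨h, by omega, e⟩) }

theorem Propagation.le_of_flip (P : Propagation n l inp V K j a g F N C L t h x) {c : ℕ}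
    (hc : F c = g) : c ≤ j := by
  obtain ⟨k, hk, rfl⟩ := P.mem_queue c hc
  exact P.queue_le k hk

/-- A stamped row already disagrees, under every solution with `w j = a`, in its cause column; now
it also disagrees in `L h`. The two columns differ, since queue entries are distinct and rows below
`x` have not yet been stamped for `L h`. -/
theorem Propagation.clash (P : Propagation n l inp V K j a g F N C L t h x)
    (hV : ∀ c, V c < 2) (hh : h < t) {i : ℕ} (hi : i < n) (hix : i < x) (hN : N i = g)
    (he : inp (i * l + L h) = V (L h)) (w : ℕ → ℕ) (hw : Good n l inp (j + 1) w) : w j ≠ a := by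
  intro hwj
  obtain ⟨h1, h2, -⟩ := P.cause i hi hN
  have mm : ∀ c, F c = g → inp (i * l + c) = V c → Mismatch l inp w i c := fun c hc e =>
    ⟨by have := hV c; omega, by rw [e]; exact (P.forced w hw hwj c hc).symm⟩
  have h3 := P.flip_queue h hh
  have h4 := P.le_of_flip h1
  have h5 := P.le_of_flip h3
  have e := hw.2 i hi _ (by omega) _ (by omega) (mm _ h1 h2) (mm _ h3 he)
  rcases P.stamped i hi hN with ⟨k, hk, e'⟩ | ⟨-, hx⟩
  · have := P.queue_inj k (by omega) h hh (e'.symm.trans e)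
    omega
  · omega

/-- The column in which row `i` disagrees is forced to be flipped, too. -/
theorem Propagation.forced_partner (P : Propagation n l inp V K j a g F N C L t h x)
    (hK : Tracks n l inp j V K) (hh : h < t) {i : ℕ} (hi : i < n)
    (he : inp (i * l + L h) = V (L h)) (hp : K i < l) (w : ℕ → ℕ)
    (hw : Good n l inp (j + 1) w) (hwj : w j = a) : w (K i) ≠ V (K i) := by
  have hKj : K i < j := (hK.range i hi).resolve_right hp.ne
  obtain ⟨h1, h2⟩ := (hK.mismatch_iff i hi _ hKj).2 rfl
  have h3 := P.flip_queue h hh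
  have h4 := P.le_of_flip h3
  intro e
  have m1 : Mismatch l inp w i (K i) := ⟨h1, by rwa [e]⟩
  have m2 : Mismatch l inp w i (L h) :=
    ⟨by have := hK.lt_two (L h); omega, by rw [he]; exact (P.forced w hw hwj _ h3).symm⟩
  -- Otherwise `w` would disagree with row `i` in both columns, forcing them to be equal; but `V`
  -- disagrees with the row in one and agrees in the other.
  have e' := hw.2 i hi _ (by omega) _ (by omega) m1 m2
  rw [e'] at h2
  exact h2 he

theorem Propagation.enqueue (P : Propagation n l inp V K j a g F N C L t h x) (hh : h < t)
    {m : ℕ} (hm : m ≤ j) (hF : F m ≠ g)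
    (hforced : ∀ w, Good n l inp (j + 1) w → w j = a → w m ≠ V m) :
    Propagation n l inp V K j a g (Function.update F m g) N C (Function.update L t m)
      (t + 1) h x := by
  have hL : ∀ k < t, Function.update L t m k = L k := fun k hk => Function.update_of_ne hk.ne _ _
  have hFm : ∀ c, F c = g → Function.update F m g c = g := fun c hc => by
    rw [Function.update_of_ne, hc]
    rintro rfl
    exact hF hc
  have hne : ∀ k < t, L k ≠ m := fun k hk e => hF (e ▸ P.flip_queue k hk)
  refine ⟨fun c => ?_, P.stamp_le, hFm _ P.start, fun k hk => ?_, fun k hk => ?_, fun c hc => ?_,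
    fun k hk k' hk' e => ?_, fun i hi hs => ?_, fun w hw hwj c hc => ?_, fun k hk i hi he => ?_,
    fun i hi hx he => ?_, fun i hi hs => ?_⟩
  · rw [Function.update_apply]
    split_ifs
    exacts [le_rfl, P.flip_le c]
  · rcases Nat.lt_succ_iff_lt_or_eq.1 hk with hk | rfl
    · rw [hL k hk]; exact P.queue_le k hk
    · simpa using hm
  · rcases Nat.lt_succ_iff_lt_or_eq.1 hk with hk | rfl
    · rw [hL k hk]; exact hFm _ (P.flip_queue k hk)
    · simp
  · by_cases h : c = m
    · exact ⟨t, by omega, by simp [h]⟩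
    · rw [Function.update_of_ne h] at hc
      obtain ⟨k, hk, e⟩ := P.mem_queue c hc
      exact ⟨k, by omega, by rw [hL k hk, e]⟩
  · rcases Nat.lt_succ_iff_lt_or_eq.1 hk with hk | rfl <;>
      rcases Nat.lt_succ_iff_lt_or_eq.1 hk' with hk' | rfl
    · rw [hL k hk, hL k' hk'] at e
      exact P.queue_inj k hk k' hk' e
    · rw [hL k hk, Function.update_self] at e
      exact absurd e (hne k hk)
    · rw [hL k' hk', Function.update_self] at e
      exact absurd e.symm (hne k' hk')
    · rfl
  · obtain ⟨h1, h2, h3⟩ := P.cause i hi hs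
    exact ⟨hFm _ h1, h2, fun h => hFm _ (h3 h)⟩
  · by_cases h : c = m
    · exact h ▸ hforced w hw hwj
    · rw [Function.update_of_ne h] at hc
      exact P.forced w hw hwj c hc
  · rw [hL k (by omega)] at he ⊢
    exact P.processed k hk i hi he
  · rw [hL h hh] at he ⊢
    exact P.current i hi hx he
  · rw [hL h hh]
    rcases P.stamped i hi hs with ⟨k, hk, e⟩ | e
    · exact Or.inl ⟨k, hk, by rw [hL k (by omega), e]⟩
    · exact Or.inr e

/-- By `hK` the old disagreement of row `i` is flipped away, leaving `L h` as its only one. -/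
theorem Propagation.stamp {i : ℕ} (P : Propagation n l inp V K j a g F N C L t h (i + 1))
    (hh : h < t) (hN : N i ≠ g) (he : inp (i * l + L h) = V (L h)) (hK : K i < l → F (K i) = g) :
    Propagation n l inp V K j a g F (Function.update N i g) (Function.update C i (L h)) L
      t h i := by
  have hNi : ∀ i', N i' = g → i' ≠ i := by
    rintro i' h rfl
    exact hN h
  have keep : ∀ i' c, N i' = g ∧ C i' = c →
      Function.update N i g i' = g ∧ Function.update C i (L h) i' = c := by
    rintro i' c ⟨h1, h2⟩
    rw [Function.update_of_ne (hNi _ h1), Function.update_of_ne (hNi _ h1)]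
    exact ⟨h1, h2⟩
  refine { P with
    stamp_le := fun i' => ?_
    cause := fun i' hi' hs => ?_
    processed := fun k hk i' hi' e => keep _ _ (P.processed k hk i' hi' e)
    current := fun i' hi' hx e => ?_
    stamped := fun i' hi' hs => ?_ }
  · rw [Function.update_apply]
    split_ifs
    exacts [le_rfl, P.stamp_le i']
  · by_cases h : i' = i
    · subst h
      simp only [Function.update_self]
      exact ⟨P.flip_queue _ hh, he, hK⟩
    · rw [Function.update_of_ne h] at hs ⊢
      exact P.cause i' hi' hs
  · by_cases h : i' = i
    · subst h
      simp
    · exact keep _ _ (P.current i' hi' (by omega) e)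
  · by_cases h : i' = i
    · subst h
      exact Or.inr (by simp)
    · rw [Function.update_of_ne h] at hs ⊢
      exact (P.stamped i' hi' hs).imp_right fun ⟨h1, h2⟩ => ⟨h1, by omega⟩

/-- The assignment after flipping. -/
def flipped (g : ℕ) (F V : ℕ → ℕ) (c : ℕ) : ℕ := if F c = g then 1 - V c else V c

/-- The disagreeing columns after flipping. -/
def remiss (l g : ℕ) (F N C K : ℕ → ℕ) (i : ℕ) : ℕ :=
  if N i = g then C i else if K i < l ∧ F (K i) = g then l else K i

/-- Once the queue is exhausted, a stamped row disagrees exactly in its cause. An unstamped row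
meets no new disagreement, and loses its old one if that column was flipped. -/
theorem Propagation.tracks (P : Propagation n l inp V K j a g F N C L t t n)
    (hK : Tracks n l inp j V K) (hj : j < l) (hinp : ∀ q, inp q ≤ 2) :
    Tracks n l inp (j + 1) (flipped g F V) (remiss l g F N C K) where
  lt_two c := by
    have := hK.lt_two c
    unfold flipped
    split_ifs <;> omega
  mismatch_iff i hi c hc := by
    have hV := hK.lt_two c
    by_cases hF : F c = g
    · have e1 : Mismatch l inp (flipped g F V) i c ↔
          inp (i * l + c) ≠ 2 ∧ inp (i * l + c) ≠ 1 - V c := by simp [Mismatch, flipped, hF]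
      rw [e1]
      constructor
      · rintro ⟨h1, h2⟩
        have := hinp (i * l + c)
        obtain ⟨k, hk, rfl⟩ := P.mem_queue c hF
        obtain ⟨h3, h4⟩ := P.processed k hk i hi (by omega)
        rw [remiss, if_pos h3, h4]
      · intro h
        unfold remiss at h
        split_ifs at h with h1 h2
        · subst h
          have := (P.cause i hi h1).2.1
          omega
        · omega
        · exact absurd ⟨by omega, by rw [h, hF]⟩ h2
    · have hcj : c < j := by
        rcases Nat.lt_succ_iff_lt_or_eq.1 hc with h | rfl
        · exact h
        · exact absurd P.start hF
      have e1 : Mismatch l inp (flipped g F V) i c ↔ Mismatch l inp V i c := by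
        simp [Mismatch, flipped, hF]
      rw [e1, hK.mismatch_iff i hi c hcj]
      unfold remiss
      split_ifs with h1 h2
      · obtain ⟨h2, -, h3⟩ := P.cause i hi h1
        constructor
        · rintro rfl
          exact absurd (h3 (by omega)) hF
        · rintro rfl
          exact absurd h2 hF
      · constructor
        · rintro rfl
          exact absurd h2.2 hF
        · intro h
          omega
      · rfl
  range i hi := by
    unfold remiss
    split_ifs with h1 h2
    · have := P.le_of_flip (P.cause i hi h1).1
      omega
    · exact Or.inr rfl
    · have := hK.range i hi
      omega

/-- The number of stamped rows. -/
def stampCount (n g : ℕ) (N : ℕ → ℕ) : ℕ := ((Finset.range n).filter fun i => N i = g).card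

theorem stampCount_le (n g : ℕ) (N : ℕ → ℕ) : stampCount n g N ≤ n := by
  simpa [stampCount] using Finset.card_filter_le (Finset.range n) fun i => N i = g

theorem stampCount_update {i : ℕ} (hi : i < n) (hN : N i ≠ g) :
    stampCount n g (Function.update N i g) = stampCount n g N + 1 := by
  unfold stampCount
  rw [← Finset.card_insert_of_notMem (a := i) (by simp [hN])]
  congr 1
  ext i'
  by_cases h : i' = i
  · simp [h, hi]
  · simp [h]

end

/-! ### The program for one trial -/

theorem St.seta_A_self (σ : St) (a : Arr) (i v : ℕ) :
    (σ.seta a i v).A a = Function.update (σ.A a) i v := by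
  funext q
  simp [Function.update_apply]

theorem St.seta_A_of_ne (σ : St) {a a' : Arr} (h : a' ≠ a) (i v : ℕ) :
    (σ.seta a i v).A a' = σ.A a' := by
  funext q
  simp [h]

theorem St.setr_setr (σ : St) (x : Reg) (u v : ℕ) : (σ.setr x u).setr x v = σ.setr x v := by
  unfold St.setr
  congr 1
  funext y
  dsimp only
  split_ifs <;> rfl

/-- Queue the column in which the row in register `row` has disagreed so far. -/
def enqueuePartner : Cmd :=
  .load .partner .mis .row ;;
  .ite (.lt .partner .cols)
    (.load .tmpA .flip .partner ;;
      .ite (.eq .tmpA .tag) .skip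
        (.store .flip .partner .tag ;; .store .queue .tail .partner ;; .add .tail .tail .one))
    .skip

/-- Advance to the previous row that newly disagrees with the column in register `cur`. -/
def fetch : Cmd :=
  .mul .addr .row .cols ;; .add .addr .addr .cur ;; .add .addr .addr .addr ;;
  .add .addr .addr .old ;; .load .next .prev .addr

/-- Visit the rows that newly disagree with the flipped column in register `cur`. -/
def scan : Cmd :=
  .loop (.lt .zero .next)
    (.sub .row .next .one ;; .load .tmpA .stamp .row ;;
      -- A clash ends both loops: `next = 0` stops the scan, and `head = tail` stops the processing
      -- of the queue.
      .ite (.eq .tmpA .tag) (.set .clash 1 ;; .set .next 0 ;; .mov .head .tail)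
        (enqueuePartner ;; .store .stamp .row .tag ;; .store .cause .row .cur ;; fetch))

/-- Process the queue of flipped columns. -/
def propagate : Cmd :=
  .loop (.lt .head .tail)
    (.load .cur .queue .head ;; .load .old .val .cur ;;
      .add .addr .cells .cur ;; .add .addr .addr .addr ;; .add .addr .addr .old ;;
      .load .next .prev .addr ;; scan ;; .add .head .head .one)

/-- Try to give the value `a` to the column in register `col`. -/
def trial (a : ℕ) : Cmd :=
  .set .old (1 - a) ;; .store .val .col .old ;;
  -- The tag `2 * col + a + 1` is positive and increases from trial to trial, so neither the initial
  -- zeros nor older stamps equal it.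
  .add .tag .col .col ;; .set .tmpA (a + 1) ;; .add .tag .tag .tmpA ;;
  .store .flip .col .tag ;; .set .head 0 ;; .store .queue .head .col ;;
  .set .tail 1 ;; .set .clash 0 ;; propagate

/-- What propagation leaves unchanged. -/
def Frame (n l M j g r : ℕ) (P V K : ℕ → ℕ) (σ : St) : Prop :=
  Consts n l M σ ∧ σ.r .col = j ∧ σ.r .tag = g ∧ σ.r .ans = r ∧ σ.A .prev = P ∧ σ.A .val = V ∧
    σ.A .mis = K

/-- Propagation has derived a contradiction. -/
def Refuted (n l : ℕ) (inp : ℕ → ℕ) (j a g : ℕ) (σ : St) : Prop :=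
  σ.r .clash = 1 ∧ (∀ c, σ.A .flip c ≤ g) ∧ (∀ i, σ.A .stamp i ≤ g) ∧
    ∀ w, Good n l inp (j + 1) w → w j ≠ a

section
variable {n l M B : ℕ} {inp : ℕ → ℕ} {P V K : ℕ → ℕ} {j a g r : ℕ}

/-- Propagation is in progress, and no contradiction has been found. -/
def Ongoing (n l : ℕ) (inp V K : ℕ → ℕ) (j a g h x : ℕ) (σ : St) (T : ℤ) : Prop :=
  σ.r .clash = 0 ∧
  Propagation n l inp V K j a g (σ.A .flip) (σ.A .stamp) (σ.A .cause) (σ.A .queue) (σ.r .tail) h x ∧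
  -- Besides column `j`, a column is queued only when a row is about to be stamped.
  σ.r .tail ≤ 1 + stampCount n g (σ.A .stamp) ∧
  -- The potential: 300 per unstamped row and 100 per waiting column. A new stamp releases at least
  -- 200 even if it queues a column, which pays for one round of the scan; each finished column
  -- releases 100.
  300 * ((n : ℤ) - stampCount n g (σ.A .stamp)) + 100 * ((σ.r .tail : ℤ) - h) ≤ T

theorem wp_fetch (hM : M = n * l) (hB : 4 * M + 10 * n + 10 * l + 200 ≤ B)
    (hP : HasPrev n l inp P) (σ : St) (T : ℤ) (d2 : σ.r .cols = l) (f4 : σ.A .prev = P) {i : ℕ}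
    (hi : i < n) (hrow : σ.r .row = i) (hc : σ.r .cur < l) (ho : σ.r .old < 2)
    (Q : St → ℤ → Prop)
    (hQ : ∀ v, Q ((σ.setr .addr v).setr .next
      (prevRow (fun i j => inp (i * l + j)) (σ.r .cur) (σ.r .old) i)) (T - 9)) :
    wp B M inp fetch Q σ T := by
  have h1 : i * l + l ≤ M := by
    rw [hM, ← Nat.succ_mul]; exact Nat.mul_le_mul_right l hi
  simp only [fetch, wp, St.setr_setr, St.setr_r, St.setr_A, reduceCtorEq, if_true, if_false, d2,
    hrow, f4]
  refine ⟨by omega, by omega, by omega, by omega, ?_⟩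
  have e := hP i hi.le _ hc _ ho
  rw [two_mul] at e
  rw [e]
  convert hQ _ using 1
  ring

theorem wp_enqueuePartner (hB : 4 * M + 10 * n + 10 * l + 200 ≤ B)
    (hK : Tracks n l inp j V K) (σ : St) (T : ℤ) {h x i : ℕ}
    (hσ : Frame n l M j g r P V K σ) (hht : h < σ.r .tail) (htn : σ.r .tail ≤ n + 1)
    (hrow : σ.r .row = i) (hi : i < n)
    (hp : Propagation n l inp V K j a g (σ.A .flip) (σ.A .stamp) (σ.A .cause) (σ.A .queue)
      (σ.r .tail) h x)
    (he : inp (i * l + σ.A .queue h) = V (σ.A .queue h))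
    (Q : St → ℤ → Prop)
    (hQ : ∀ σ' T', Frame n l M j g r P V K σ' →
      (∀ y, y ≠ .partner → y ≠ .tmpA → y ≠ .tail → σ'.r y = σ.r y) →
      σ'.A .stamp = σ.A .stamp → σ'.A .cause = σ.A .cause → σ'.A .queue h = σ.A .queue h →
      σ.r .tail ≤ σ'.r .tail → σ'.r .tail ≤ σ.r .tail + 1 →
      Propagation n l inp V K j a g (σ'.A .flip) (σ.A .stamp) (σ.A .cause) (σ'.A .queue)
        (σ'.r .tail) h x →
      (K i < l → σ'.A .flip (K i) = g) → T - 30 ≤ T' → Q σ' T') :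
    wp B M inp enqueuePartner Q σ T := by
  obtain ⟨⟨d1, d2, d3, d4, d5⟩, f1, f2, f3, f4, f5, f6⟩ := hσ
  simp only [enqueuePartner, wp, St.setr_r, St.setr_A, St.seta_r, Cond.holds_eq, Cond.holds_lt,
    reduceCtorEq, if_true, if_false, d2, d5, f2, f6, hrow]
  refine ⟨fun hKl => ⟨fun hF => ?_, fun hF => ⟨by omega, ?_⟩⟩, fun hKl => ?_⟩
  · refine hQ _ _ ?_ ?_ rfl rfl rfl (by simp) (by simp) hp (fun _ => hF) (by omega)
    · simp [Frame, Consts, *]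
    · intro y h1 h2 h3
      simp [h1, h2]
  · have hKj : K i < j := (hK.range i hi).resolve_right hKl.ne
    have hq := hp.enqueue hht hKj.le hF (hp.forced_partner hK hht hi he hKl)
    refine hQ _ _ ?_ ?_ ?_ ?_ ?_ (by simp) (by simp) ?_ ?_ (by omega)
    · simp [Frame, Consts, St.seta_A_of_ne, *]
    · intro y h1 h2 h3
      simp [h1, h2, h3]
    · simp [St.seta_A_of_ne]
    · simp [St.seta_A_of_ne]
    · simp [hht.ne]
    · simpa [St.seta_A_of_ne, St.seta_A_self] using hq
    · intro _
      simp
  · refine hQ _ _ ?_ ?_ rfl rfl rfl (by simp) (by simp) hp (fun h => absurd h hKl) (by omega)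
    · simp [Frame, Consts, *]
    · intro y h1 h2 h3
      simp [h1]

/-- `T₀` is credit reserved for what follows the scan. The loop invariant is either that all rows
from `next` on have been scanned without a clash, or that the value `a` has been refuted. -/
theorem wp_scan (hM : M = n * l) (hB : 4 * M + 10 * n + 10 * l + 200 ≤ B)
    (hP : HasPrev n l inp P) (hK : Tracks n l inp j V K) (hj : j < l) (σ : St) (T T₀ : ℤ) (h : ℕ)
    (hT₀ : 20 ≤ T₀)
    (hσ : Frame n l M j g r P V K σ) (hh : σ.r .head = h) (hht : h < σ.r .tail)
    (hc : σ.r .cur = σ.A .queue h) (ho : σ.r .old = V (σ.A .queue h)) (hx : σ.r .next ≤ n)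
    (hx' : 0 < σ.r .next → inp ((σ.r .next - 1) * l + σ.A .queue h) = V (σ.A .queue h))
    (hO : Ongoing n l inp V K j a g h (σ.r .next) σ (T - T₀))
    (Q : St → ℤ → Prop)
    (hQ : ∀ σ' T', Frame n l M j g r P V K σ' →
      ((σ'.r .head = h ∧ h < σ'.r .tail ∧ Ongoing n l inp V K j a g h 0 σ' (T' + 1 - T₀)) ∨
        (σ'.r .tail ≤ σ'.r .head ∧ σ'.r .head ≤ n + 1 ∧ Refuted n l inp j a g σ' ∧
          T₀ + 40 ≤ T')) → Q σ' T') :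
    wp B M inp scan Q σ T := by
  simp only [scan, wp]
  refine ⟨fun σ' T' => Frame n l M j g r P V K σ' ∧
    ((σ'.r .head = h ∧ h < σ'.r .tail ∧ σ'.r .cur = σ'.A .queue h ∧
      σ'.r .old = V (σ'.A .queue h) ∧ σ'.r .next ≤ n ∧
      (0 < σ'.r .next → inp ((σ'.r .next - 1) * l + σ'.A .queue h) = V (σ'.A .queue h)) ∧
      Ongoing n l inp V K j a g h (σ'.r .next) σ' (T' - T₀)) ∨
    (σ'.r .next = 0 ∧ σ'.r .tail ≤ σ'.r .head ∧ σ'.r .head ≤ n + 1 ∧ Refuted n l inp j a g σ' ∧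
      T₀ + 41 ≤ T')), ⟨hσ, Or.inl ⟨hh, hht, hc, ho, hx, hx', hO⟩⟩, ?_⟩
  clear hσ hh hht hc ho hx hx' hO σ T
  rintro σ T ⟨⟨⟨d1, d2, d3, d4, d5⟩, f1, f2, f3, f4, f5, f6⟩, H⟩
  simp only [Cond.holds_lt, d4]
  rcases H with ⟨hh, hht, hc, ho, hx, hx', hO⟩ | ⟨hx, hht, hh, hR, hT⟩
  swap
  · refine ⟨by omega, fun hb => by omega, fun _ => hQ _ _
      ⟨⟨d1, d2, d3, d4, d5⟩, f1, f2, f3, f4, f5, f6⟩ (Or.inr ⟨hht, hh, hR, by omega⟩)⟩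
  obtain ⟨o1, o2, o3, o4⟩ := hO
  have hcount := stampCount_le n g (σ.A .stamp)
  refine ⟨by omega, fun hb => ?_, fun hb => ?_⟩
  swap
  · have hx0 : σ.r .next = 0 := by omega
    rw [hx0] at o2
    exact hQ _ _ ⟨⟨d1, d2, d3, d4, d5⟩, f1, f2, f3, f4, f5, f6⟩
      (Or.inl ⟨hh, hht, o1, o2, o3, by omega⟩)
  have he := hx' hb
  obtain ⟨i, hi⟩ : ∃ i, σ.r .next = i + 1 := ⟨σ.r .next - 1, by omega⟩
  rw [hi] at o2 hx
  rw [hi, Nat.add_sub_cancel] at he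
  have htail := hcount.trans' (Nat.sub_le_of_le_add (by omega) : σ.r .tail - 1 ≤ _)
  have hFr : Frame n l M j g r P V K (((σ.setr .row i)).setr .tmpA (σ.A .stamp i)) := by
    simp [Frame, Consts, *]
  simp only [St.setr_r, St.setr_A, Cond.holds_eq, reduceCtorEq, if_true, if_false, d5, f2, hi,
    Nat.add_sub_cancel]
  refine ⟨fun hs => ⟨by omega, by omega, ?_, Or.inr ⟨?_, ?_, ?_, ⟨?_, ?_, ?_, ?_⟩, ?_⟩⟩,
    fun hs => ?_⟩
  · simp [Frame, Consts, *]
  · trivial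
  · exact le_rfl
  · omega
  · rfl
  · exact o2.flip_le
  · exact o2.stamp_le
  · exact o2.clash hK.lt_two hht hx (Nat.lt_succ_self i) hs he
  · omega
  refine wp_enqueuePartner hB hK _ _ hFr (by simpa using hht) (by simp; omega) (by simp) hx
    (by simpa using o2) (by simpa using he) _ ?_
  intro σ1 T1 hF1 er es ec eq ht1 ht2 hp1 hk1 hT1
  have hstampi : σ.A .stamp i ≠ g := hs
  have er' : ∀ y, y ≠ .partner → y ≠ .tmpA → y ≠ .tail → y ≠ .row → σ1.r y = σ.r y := by
    intro y h1 h2 h3 h4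
    simp [er y h1 h2 h3, h2, h4]
  have hrow : σ1.r .row = i := by rw [er] <;> simp
  have hcur : σ1.r .cur = σ.A .queue h := by rw [er'] <;> simp [hc]
  have hold : σ1.r .old = V (σ.A .queue h) := by rw [er'] <;> simp [ho]
  have hq : σ1.A .queue h = σ.A .queue h := by simpa using eq
  simp only [St.setr_A] at es ec hp1
  simp only [St.setr_r, reduceCtorEq, if_false] at ht1 ht2
  obtain ⟨⟨g1, g2, g3, g4, g5⟩, k1, k2, k3, k4, k5, k6⟩ := hF1
  have hcl := hp1.queue_le h (by omega)
  rw [hq] at hcl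
  refine wp_fetch hM hB hP (i := i) _ _ (by simpa using g2) (by simpa [St.seta_A_of_ne] using k4) hx
    (by simpa using hrow) (by simp only [St.seta_r, hcur]; omega)
    (by simp only [St.seta_r, hold]; exact hK.lt_two _) _ ?_
  intro v
  simp only [St.seta_r, hcur, hold]
  have hp2 := hp1.stamp (by omega) hstampi (by rw [hq]; exact he) hk1
  have hpr := prevRow_le (fun i j => inp (i * l + j)) (σ.A .queue h) (V (σ.A .queue h)) i
  have hp3 := hp2.lower hpr (by
    rw [hq]
    exact fun k hk hki => entry_ne_of_prevRow_le _ _ _ i hk hki)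
  rw [hq] at hp3
  have hcnt := stampCount_update hx hstampi
  refine ⟨?_, Or.inl ⟨?_, ?_, ?_, ?_, ?_, ?_, ?_, ?_, ?_, ?_⟩⟩
  · simp [Frame, Consts, St.seta_A_of_ne, *]
  · simp [er', hh]
  · simp only [St.setr_r, St.seta_r, reduceCtorEq, if_false]
    omega
  · simp [hcur, hq]
  · simp [hold, hq]
  · simp; omega
  · intro hpos
    simp only [St.setr_r, if_true] at hpos
    simp only [St.setr_r, if_true, St.setr_A, St.seta_A_of_ne, ne_eq, reduceCtorEq,
      not_false_eq_true, hq]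
    exact entry_prevRow _ _ _ i hpos
  · simp [er', o1]
  · simpa [St.seta_A_of_ne, St.seta_A_self, es, ec, hrow, k2, hcur] using hp3
  · simp only [St.setr_r, St.setr_A, St.seta_r, reduceCtorEq, if_false, St.seta_A_of_ne, ne_eq,
      not_false_eq_true, St.seta_A_self, es, hrow, k2, hcnt]
    omega
  · simp only [St.setr_r, St.setr_A, St.seta_r, reduceCtorEq, if_false, St.seta_A_of_ne, ne_eq,
      not_false_eq_true, St.seta_A_self, es, hrow, k2, hcnt]
    push_cast
    omega

end

section
variable {n l M B : ℕ} {inp : ℕ → ℕ} {P V K : ℕ → ℕ} {j a g r : ℕ}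

theorem wp_propagate (hM : M = n * l) (hB : 4 * M + 10 * n + 10 * l + 200 ≤ B)
    (hP : HasPrev n l inp P) (hK : Tracks n l inp j V K) (hj : j < l) (σ : St) (T T₀ : ℤ)
    (hT₀ : 40 ≤ T₀) (hσ : Frame n l M j g r P V K σ) (hht : σ.r .head ≤ σ.r .tail)
    (hO : Ongoing n l inp V K j a g (σ.r .head) n σ (T - T₀ - 1))
    (Q : St → ℤ → Prop)
    (hQ : ∀ σ' T', Frame n l M j g r P V K σ' →
      ((σ'.r .clash = 0 ∧ σ'.r .tail ≤ n + 1 ∧ Propagation n l inp V K j a g (σ'.A .flip)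
        (σ'.A .stamp) (σ'.A .cause) (σ'.A .queue) (σ'.r .tail) (σ'.r .tail) n) ∨
        Refuted n l inp j a g σ') → T₀ ≤ T' → Q σ' T') :
    wp B M inp propagate Q σ T := by
  simp only [propagate, wp]
  refine ⟨fun σ' T' => Frame n l M j g r P V K σ' ∧
    ((σ'.r .head ≤ σ'.r .tail ∧ Ongoing n l inp V K j a g (σ'.r .head) n σ' (T' - T₀ - 1)) ∨
    (σ'.r .tail ≤ σ'.r .head ∧ Refuted n l inp j a g σ' ∧ T₀ + 1 ≤ T')),
    ⟨hσ, Or.inl ⟨hht, hO⟩⟩, ?_⟩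
  clear hσ hht hO σ T
  rintro σ T ⟨hF, H⟩
  simp only [Cond.holds_lt]
  rcases H with ⟨hht, hO⟩ | ⟨hht, hR, hT⟩
  swap
  · exact ⟨by omega, fun hb => by omega, fun _ => hQ _ _ hF (Or.inr hR) (by omega)⟩
  obtain ⟨o1, o2, o3, o4⟩ := hO
  have hcount := stampCount_le n g (σ.A .stamp)
  refine ⟨by omega, fun hb => ?_, fun hb => ?_⟩
  swap
  · have e : σ.r .head = σ.r .tail := by omega
    rw [e] at o2
    exact hQ _ _ hF (Or.inl ⟨o1, by omega, o2⟩) (by omega)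
  have hc := o2.queue_le _ hb
  obtain ⟨⟨d1, d2, d3, d4, d5⟩, f1, f2, f3, f4, f5, f6⟩ := hF
  have hv := hK.lt_two (σ.A .queue (σ.r .head))
  simp only [St.setr_setr, St.setr_r, St.setr_A, reduceCtorEq, if_true, if_false, d3, f4, f5]
  have e := hP n le_rfl _ (by omega : σ.A .queue (σ.r .head) < l) _ hv
  rw [← hM, two_mul] at e
  rw [e]
  have hpr := prevRow_le (fun i j => inp (i * l + j)) (σ.A .queue (σ.r .head))
    (V (σ.A .queue (σ.r .head))) n
  refine ⟨by omega, by omega, by omega, ?_⟩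
  -- The 19 steps before the scan, less the offset 1 in the invariant, are taken from the reserve,
  -- so the potential carries over unchanged.
  refine wp_scan (a := a) (g := g) (r := r) hM hB hP hK hj _ _ (T₀ - 18) (σ.r .head) (by omega)
    ?_ ?_ ?_ ?_ ?_ ?_ ?_ ?_ _ ?_
  · simp [Frame, Consts, *]
  · simp
  · simpa using hb
  · simp
  · simp
  · simpa using hpr
  · intro hpos
    simp only [St.setr_r, if_true] at hpos
    simpa using entry_prevRow _ _ _ n hpos
  · refine ⟨by simpa using o1, ?_, by simpa using o3, ?_⟩
    · have := o2.lower hpr fun i hi hin => entry_ne_of_prevRow_le _ _ _ n hi hin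
      simpa using this
    · simp only [St.setr_r, St.setr_A, reduceCtorEq, if_false]
      omega
  · intro σ1 T1 hF1 H1
    have hF2 := hF1
    obtain ⟨⟨g1, g2, g3, g4, g5⟩, k1, k2, k3, k4, k5, k6⟩ := hF2
    rcases H1 with ⟨hh1, hht1, p1, p2, p3, p4⟩ | ⟨hht1, hh1, hR1, hT1⟩
    · have hcount1 := stampCount_le n g (σ1.A .stamp)
      simp only [g5]
      refine ⟨by omega, by simp [Frame, Consts, *], Or.inl ⟨by simp; omega, ?_, ?_, ?_, ?_⟩⟩
      · simpa using p1
      · simpa [hh1] using p2.finish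
      · simpa using p3
      · simp only [St.setr_r, St.setr_A, reduceCtorEq, if_false, hh1]
        push_cast
        omega
    · simp only [g5]
      refine ⟨by omega, by simp [Frame, Consts, *], Or.inr ⟨by omega, ?_, by omega⟩⟩
      simpa [Refuted] using hR1

theorem wp_trial (hM : M = n * l) (hB : 4 * M + 10 * n + 10 * l + 200 ≤ B)
    (hP : HasPrev n l inp P) (hK : Tracks n l inp j V K) (hj : j < l) (ha : a < 2) (σ : St) (T : ℤ)
    (hc : Consts n l M σ) (f1 : σ.r .col = j) (f3 : σ.r .ans = r) (f4 : σ.A .prev = P)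
    (f5 : σ.A .val = V) (f6 : σ.A .mis = K) (hF : ∀ c, σ.A .flip c < 2 * j + a + 1)
    (hN : ∀ i, σ.A .stamp i < 2 * j + a + 1) (hT : 300 * n + 300 ≤ T) (Q : St → ℤ → Prop)
    (hQ : ∀ σ' T', Frame n l M j (2 * j + a + 1) r P (Function.update V j (1 - a)) K σ' →
      ((σ'.r .clash = 0 ∧ σ'.r .tail ≤ n + 1 ∧ Propagation n l inp (Function.update V j (1 - a)) K j
        a (2 * j + a + 1) (σ'.A .flip) (σ'.A .stamp) (σ'.A .cause) (σ'.A .queue) (σ'.r .tail)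
          (σ'.r .tail) n) ∨
        Refuted n l inp j a (2 * j + a + 1) σ') → T - 300 * n - 250 ≤ T' → Q σ' T') :
    wp B M inp (trial a) Q σ T := by
  obtain ⟨d1, d2, d3, d4, d5⟩ := hc
  simp only [trial, wp, St.setr_r, St.seta_r, reduceCtorEq, if_true, if_false, f1]
  refine ⟨by omega, by omega, by omega, by omega, by omega, by omega, by omega, ?_⟩
  refine wp_propagate (a := a) (g := 2 * j + a + 1) (r := r) hM hB hP
    (hK.update (b := 1 - a) (by omega)) hj _ _ (T - 300 * n - 240) (by omega) ?_ (by simp) ?_ _ ?_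
  · simp only [Frame, Consts, St.setr_r, St.setr_A, St.seta_r, St.seta_A_self, St.seta_A_of_ne,
      reduceCtorEq, ne_eq, not_false_eq_true, if_true, if_false, true_and, and_true, *]
    omega
  · have h0 : stampCount n (2 * j + a + 1) (σ.A .stamp) = 0 := by
      rw [stampCount, Finset.card_eq_zero, Finset.filter_eq_empty_iff]
      intro i _
      exact (hN i).ne
    have hp := Propagation.init (l := l) (inp := inp) (V := Function.update V j (1 - a)) (K := K)
      (j := j) (a := a) (C := σ.A .cause) (L := σ.A .queue) (n := n) hF hN
      (by rw [Function.update_self]; omega)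
    have eg : j + j + (a + 1) = 2 * j + a + 1 := by omega
    refine ⟨by simp, ?_, ?_, ?_⟩
    · simpa [St.seta_A_self, St.seta_A_of_ne, eg, f5] using hp
    · simp
    · simp [St.seta_A_of_ne, h0]
      omega
  · intro σ' T' h1 h2 h3
    exact hQ σ' T' h1 h2 (by omega)

end

/-! ### Adopting the flips of a successful trial -/

/-- Flip the queued columns. -/
def commitVal : Cmd :=
  .set .head 0 ;;
  .loop (.lt .head .tail)
    (.load .cur .queue .head ;; .load .old .val .cur ;; .sub .old .one .old ;;
      .store .val .cur .old ;; .add .head .head .one)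

/-- Update the columns in which the rows disagree. -/
def commitMis : Cmd :=
  .set .row 0 ;;
  .loop (.lt .row .rows)
    (.load .tmpA .stamp .row ;;
      .ite (.eq .tmpA .tag)
        (.load .cur .cause .row ;; .store .mis .row .cur ;; .add .row .row .one)
        (.load .partner .mis .row ;;
          .ite (.lt .partner .cols)
            (.load .tmpA .flip .partner ;;
              .ite (.eq .tmpA .tag) (.store .mis .row .cols ;; .add .row .row .one)
                (.add .row .row .one))
            (.add .row .row .one)))

section
variable {n l M B : ℕ} {inp : ℕ → ℕ} {P V K : ℕ → ℕ} {j a g r : ℕ}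

theorem wp_commitVal (hB : 4 * M + 10 * n + 10 * l + 200 ≤ B) (σ : St) (T : ℤ)
    (hσ : Frame n l M j g r P V K σ) (htail : σ.r .tail ≤ n + 1)
    (hp : Propagation n l inp V K j a g (σ.A .flip) (σ.A .stamp) (σ.A .cause) (σ.A .queue)
      (σ.r .tail) (σ.r .tail) n) (hT : 20 * n + 40 ≤ T) (Q : St → ℤ → Prop)
    (hQ : ∀ σ' T', Frame n l M j g r P (flipped g (σ.A .flip) V) K σ' →
      σ'.A .flip = σ.A .flip → σ'.A .stamp = σ.A .stamp → σ'.A .cause = σ.A .cause →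
      T - 20 * n - 40 ≤ T' → Q σ' T') :
    wp B M inp commitVal Q σ T := by
  classical
  obtain ⟨⟨d1, d2, d3, d4, d5⟩, f1, f2, f3, f4, f5, f6⟩ := hσ
  simp only [commitVal, wp]
  refine ⟨by omega, fun σ' T' => Frame n l M j g r P (σ'.A .val) K σ' ∧
    σ'.A .flip = σ.A .flip ∧ σ'.A .stamp = σ.A .stamp ∧ σ'.A .cause = σ.A .cause ∧
    σ'.A .queue = σ.A .queue ∧ σ'.r .tail = σ.r .tail ∧ σ'.r .head ≤ σ.r .tail ∧
    (∀ c, σ'.A .val c = if ∃ k < σ'.r .head, σ.A .queue k = c then 1 - V c else V c) ∧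
    T - 20 * n - 39 + 20 * (σ.r .tail - σ'.r .head) ≤ T', ?_, ?_⟩
  · refine ⟨by simp [Frame, Consts, *], rfl, rfl, rfl, rfl, rfl, by simp, by simp [f5],
      by simp; omega⟩
  rintro τ S ⟨⟨⟨e1, e2, e3, e4, e5⟩, k1, k2, k3, k4, k5, k6⟩, hF, hN, hC, hL, ht, hh, hv, hS⟩
  simp only [Cond.holds_lt]
  refine ⟨by omega, fun hb => ?_, fun hb => ?_⟩
  · rw [ht] at hb
    simp only [St.setr_setr, St.setr_r, St.setr_A, St.seta_r, St.seta_A_self, St.seta_A_of_ne,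
      reduceCtorEq, ne_eq, not_false_eq_true, if_true, if_false, e5, hL]
    refine ⟨by omega, by simp [Frame, Consts, St.seta_A_self, St.seta_A_of_ne, *], hF, hN,
      hC, trivial, ht, by omega, fun c => ?_, by push_cast; omega⟩
    by_cases hc : c = σ.A .queue (τ.r .head)
    · subst hc
      -- Queue entries are distinct, so this column has not been flipped earlier in the loop.
      rw [Function.update_self, hv, if_neg, if_pos ⟨_, Nat.lt_succ_self _, rfl⟩]
      rintro ⟨k, hk, e⟩
      have := hp.queue_inj k (by omega) _ hb e
      omega
    · rw [Function.update_of_ne hc, hv]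
      congr 1
      rw [eq_iff_iff]
      constructor
      · rintro ⟨k, hk, e⟩
        exact ⟨k, by omega, e⟩
      · rintro ⟨k, hk, e⟩
        refine ⟨k, ?_, e⟩
        rcases Nat.lt_succ_iff_lt_or_eq.1 hk with h | rfl
        · exact h
        · exact absurd e.symm hc
  · have hht : τ.r .head = σ.r .tail := by omega
    have ev : τ.A .val = flipped g (σ.A .flip) V := by
      funext c
      rw [hv, hht, flipped]
      congr 1
      rw [eq_iff_iff]
      exact ⟨fun ⟨k, hk, e⟩ => e ▸ hp.flip_queue k hk, hp.mem_queue c⟩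
    exact hQ _ _ ⟨⟨e1, e2, e3, e4, e5⟩, k1, k2, k3, k4, ev, k6⟩ hF hN hC (by omega)

theorem wp_commitMis (hB : 4 * M + 10 * n + 10 * l + 200 ≤ B) (σ : St) (T : ℤ)
    (hσ : Frame n l M j g r P V K σ) (hT : 40 * n + 20 ≤ T) (Q : St → ℤ → Prop)
    (hQ : ∀ σ' T', Frame n l M j g r P V (σ'.A .mis) σ' →
      (∀ i < n, σ'.A .mis i = remiss l g (σ.A .flip) (σ.A .stamp) (σ.A .cause) K i) →
      σ'.A .flip = σ.A .flip → σ'.A .stamp = σ.A .stamp →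
      T - 40 * n - 20 ≤ T' → Q σ' T') :
    wp B M inp commitMis Q σ T := by
  obtain ⟨⟨d1, d2, d3, d4, d5⟩, f1, f2, f3, f4, f5, f6⟩ := hσ
  simp only [commitMis, wp]
  refine ⟨by omega, fun σ' T' => Frame n l M j g r P V (σ'.A .mis) σ' ∧
    σ'.A .flip = σ.A .flip ∧ σ'.A .stamp = σ.A .stamp ∧ σ'.A .cause = σ.A .cause ∧
    σ'.r .row ≤ n ∧ (∀ i, σ'.A .mis i = if i < σ'.r .row then
      remiss l g (σ.A .flip) (σ.A .stamp) (σ.A .cause) K i else K i) ∧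
    T - 40 * n - 19 + 40 * (n - σ'.r .row) ≤ T', ?_, ?_⟩
  · refine ⟨by simp [Frame, Consts, *], rfl, rfl, rfl, by simp, by simp [f6], by simp; omega⟩
  rintro τ S ⟨⟨⟨e1, e2, e3, e4, e5⟩, k1, k2, k3, k4, k5, -⟩, hF, hN, hC, hr, hv, hS⟩
  simp only [Cond.holds_lt, e1]
  refine ⟨by omega, fun hb => ?_, fun hb => ?_⟩
  · have hK : τ.A .mis (τ.r .row) = K (τ.r .row) := by rw [hv, if_neg (by omega)]
    have keep : ∀ u, u = remiss l g (σ.A .flip) (σ.A .stamp) (σ.A .cause) K (τ.r .row) →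
        ∀ i, Function.update (τ.A .mis) (τ.r .row) u i = if i < τ.r .row + 1 then
          remiss l g (σ.A .flip) (σ.A .stamp) (σ.A .cause) K i else K i := by
      rintro u rfl i
      by_cases hi : i = τ.r .row
      · subst hi
        simp
      · rw [Function.update_of_ne hi, hv]
        have : i < τ.r .row ↔ i < τ.r .row + 1 := by omega
        simp only [this]
    simp only [St.setr_r, St.setr_A, St.seta_r, St.seta_A_self, St.seta_A_of_ne,
      Cond.holds_eq, reduceCtorEq, ne_eq, not_false_eq_true, if_true, if_false, e2, e5, k2, hF, hN,
      hC, hK]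
    refine ⟨fun h1 => ⟨by omega, by simp [Frame, Consts, St.seta_A_self, St.seta_A_of_ne, *],
      trivial, trivial, trivial, by omega,
      ?_, by push_cast; omega⟩, fun h1 => ⟨fun h2 => ⟨fun h3 => ⟨by omega,
      by simp [Frame, Consts, St.seta_A_self, St.seta_A_of_ne, *],
      trivial, trivial, trivial, by omega, ?_, by push_cast; omega⟩,
      fun h3 => ⟨by omega, by simp [Frame, Consts, *], trivial, trivial, trivial, by omega,
      ?_, by push_cast; omega⟩⟩, fun h2 => ⟨by omega, by simp [Frame, Consts, *],
      trivial, trivial, trivial, by omega, ?_, by push_cast; omega⟩⟩⟩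
    · exact keep _ (by rw [remiss, if_pos h1])
    · exact keep _ (by rw [remiss, if_neg h1, if_pos ⟨h2, h3⟩])
    · have := keep (K (τ.r .row)) (by rw [remiss, if_neg h1, if_neg fun h => h3 h.2])
      rwa [← hK, Function.update_eq_self] at this
    · have := keep (K (τ.r .row)) (by rw [remiss, if_neg h1, if_neg fun h => h2 h.1])
      rwa [← hK, Function.update_eq_self] at this
  · refine hQ _ _ ⟨⟨e1, e2, e3, e4, e5⟩, k1, k2, k3, k4, k5, rfl⟩ (fun i hi => ?_) hF hN (by omega)
    rw [hv, if_pos (by omega)]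

end

/-! ### Solving column by column -/

/-- Adopt the flips and go on to the next column. -/
def commit : Cmd := commitVal ;; commitMis ;; .add .col .col .one

/-- Process the columns one by one. -/
def assignColumns : Cmd :=
  .set .row 0 ;;
  -- The value `cols` marks a row without a disagreement.
  .loop (.lt .row .rows) (.store .mis .row .cols ;; .add .row .row .one) ;;
  .set .ans 1 ;; .set .col 0 ;;
  .loop (.lt .col .cols)
    (trial 0 ;;
      .ite (.eq .clash .zero) commit
        (trial 1 ;; .ite (.eq .clash .zero) commit (.set .ans 0 ;; .mov .col .cols)))

theorem Tracks.congr {n l j : ℕ} {inp V K K' : ℕ → ℕ} (h : Tracks n l inp j V K)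
    (hK : ∀ i < n, K' i = K i) : Tracks n l inp j V K' where
  lt_two := h.lt_two
  mismatch_iff i hi c hc := by rw [hK i hi, h.mismatch_iff i hi c hc]
  range i hi := by rw [hK i hi]; exact h.range i hi

section
variable {n l M B : ℕ} {inp : ℕ → ℕ} {P V K : ℕ → ℕ} {j a g r : ℕ}

/-- The columns before `σ.r .col` have been processed successfully. -/
def Advanced (n l M r : ℕ) (inp P : ℕ → ℕ) (σ : St) : Prop :=
  Consts n l M σ ∧ σ.r .ans = r ∧ σ.A .prev = P ∧
    Tracks n l inp (σ.r .col) (σ.A .val) (σ.A .mis) ∧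
    (∀ c, σ.A .flip c < 2 * σ.r .col + 1) ∧ ∀ i, σ.A .stamp i < 2 * σ.r .col + 1

/-- All stamps are at most `2 * j + a + 1 < 2 * (j + 1) + 1`, so they are stale for the next column.
-/
theorem wp_commit (hB : 4 * M + 10 * n + 10 * l + 200 ≤ B) (hinp : ∀ q, inp q ≤ 2)
    (hK : Tracks n l inp j V K) (hj : j < l) (ha : a < 2) (σ : St) (T : ℤ)
    (hσ : Frame n l M j (2 * j + a + 1) r P V K σ) (htail : σ.r .tail ≤ n + 1)
    (hp : Propagation n l inp V K j a (2 * j + a + 1) (σ.A .flip) (σ.A .stamp) (σ.A .cause)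
      (σ.A .queue) (σ.r .tail) (σ.r .tail) n) (hT : 60 * n + 60 ≤ T) (Q : St → ℤ → Prop)
    (hQ : ∀ σ' T', Advanced n l M r inp P σ' → σ'.r .col = j + 1 → T - 60 * n - 61 ≤ T' →
      Q σ' T') :
    wp B M inp commit Q σ T := by
  have e : wp B M inp commit Q σ T = wp B M inp commitVal
    (wp B M inp commitMis (wp B M inp (.add .col .col .one) Q)) σ T := rfl
  rw [e]
  refine wp_commitVal hB σ T hσ htail hp (by omega) _ fun σ1 T1 h1 hF hN hC hT1 => ?_
  refine wp_commitMis hB σ1 T1 h1 (by omega) _ fun σ2 T2 h2 hm hF2 hN2 hT2 => ?_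
  obtain ⟨⟨e1, e2, e3, e4, e5⟩, k1, k2, k3, k4, k5, -⟩ := h2
  simp only [wp, k1, e5]
  have ht := (hp.tracks hK hj hinp).congr (K' := σ2.A .mis) fun i hi => by
    rw [hm i hi, hF, hN, hC]
  refine ⟨by omega, hQ _ _ ?_ (by simp) (by omega)⟩
  refine ⟨by simp [Consts, *], by simp [k3], by simp [k4], by simpa [k5] using ht, fun c => ?_,
    fun i => ?_⟩
  · have := hp.flip_le c
    simp only [St.setr_A, St.setr_r, if_true, hF2, hF]
    omega
  · have := hp.stamp_le i
    simp only [St.setr_A, St.setr_r, if_true, hN2, hN]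
    omega

/-- No backtracking is needed: a refutation excludes a value of column `j` in every good assignment
of the first `j + 1` columns, not only in extensions of the current one. Two trials and a commit
cost at most `1500 * n` steps, where `0 < n` absorbs the constant overhead. -/
theorem wp_assignColumns (hM : M = n * l) (hn : 0 < n)
    (hB : 4 * M + 10 * n + 10 * l + 200 ≤ B) (hinp : ∀ q, inp q ≤ 2) (σ : St) (T : ℤ)
    (hc : Consts n l M σ) (hP : HasPrev n l inp (σ.A .prev)) (hV : ∀ c, σ.A .val c = 0)
    (hF : ∀ c, σ.A .flip c = 0) (hN : ∀ i, σ.A .stamp i = 0)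
    (hT : 1500 * M + 20 * n + 20 ≤ T) (Q : St → ℤ → Prop)
    (hQ : ∀ σ' T', ((∃ w, Good n l inp l w) → σ'.r .ans = 1) →
      (¬ (∃ w, Good n l inp l w) → σ'.r .ans = 0) → T - 1500 * M - 20 * n - 20 ≤ T' → Q σ' T') :
    wp B M inp assignColumns Q σ T := by
  obtain ⟨d1, d2, d3, d4, d5⟩ := hc
  have hMZ : (M : ℤ) = n * l := by rw [hM]; push_cast; ring
  set T₀ : ℤ := T - 20 * n - 10 with hT₀
  simp only [assignColumns, wp]
  refine ⟨by omega, fun σ' T' => Consts n l M σ' ∧ σ'.A .prev = σ.A .prev ∧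
    σ'.A .val = σ.A .val ∧ σ'.A .flip = σ.A .flip ∧ σ'.A .stamp = σ.A .stamp ∧ σ'.r .row ≤ n ∧
    (∀ i < σ'.r .row, σ'.A .mis i = l) ∧ T₀ + 5 + 20 * (n - σ'.r .row) ≤ T', ?_, ?_⟩
  · exact ⟨by simp [Consts, *], rfl, rfl, rfl, rfl, by simp, by simp, by simp; omega⟩
  rintro τ S ⟨⟨e1, e2, e3, e4, e5⟩, k1, k2, k3, k4, hr, hm, hS⟩
  simp only [Cond.holds_lt, e1]
  refine ⟨by omega, fun hb => ?_, fun hb => ?_⟩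
  · simp only [St.setr_r, St.setr_A, St.seta_r, St.seta_A_of_ne, St.seta_A_self, e2, e5,
      reduceCtorEq, ne_eq, not_false_eq_true, if_true, k1, k2, k3, k4, true_and]
    refine ⟨by omega, by simp [Consts, *], by omega, fun i hi => ?_, by push_cast; omega⟩
    by_cases h : i = τ.r .row
    · simp [h]
    · rw [Function.update_of_ne h]
      exact hm i (by omega)
  have hP' : HasPrev n l inp (σ.A .prev) := hP
  have hlM : l ≤ M := hM ▸ Nat.le_mul_of_pos_left l hn
  simp only [St.setr_r, reduceCtorEq, if_false]
  have start : Advanced n l M 1 inp (σ.A .prev) ((τ.setr .ans 1).setr .col 0) := by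
    refine ⟨by simp [Consts, *], by simp, by simp [k1], ⟨fun c => ?_, by simp, fun i hi => ?_⟩,
      fun c => ?_, fun i => ?_⟩
    · simp [k2, hV]
    · exact Or.inr (hm i (by omega))
    · simp [k3, hF]
    · simp [k4, hN]
  refine ⟨by omega, by omega, fun σ' T' => 0 ≤ T' ∧ T - 1500 * M - 20 * n - 19 ≤ T' ∧
    ((Advanced n l M 1 inp (σ.A .prev) σ' ∧ σ'.r .col ≤ l ∧
      T₀ - 1500 * M + 1500 * (n * (l - σ'.r .col)) ≤ T') ∨
    (σ'.r .cols = l ∧ σ'.r .ans = 0 ∧ σ'.r .col = l ∧ ¬ ∃ w, Good n l inp l w)), ?_, ?_⟩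
  · refine ⟨by omega, by omega, Or.inl ⟨start, by simp, ?_⟩⟩
    simp only [St.setr_r, if_true, Nat.cast_zero, sub_zero, ← hMZ]
    omega
  rintro ρ R ⟨hR0, hR1, ⟨had, hcol, hR⟩ | ⟨hcols, hans, hcol, hno⟩⟩
  swap
  · refine ⟨hR0, fun h => ?_, fun _ => hQ _ _ (fun h => absurd h hno) (fun _ => hans) (by omega)⟩
    rw [hcols, hcol] at h
    exact absurd h (lt_irrefl _)
  obtain ⟨hc', hans, hprev, htr, hfl, hst⟩ := had
  have hcols := hc'.2.1
  rw [hcols]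
  refine ⟨hR0, fun hb => ?_, fun hb => ?_⟩
  swap
  · have : ρ.r .col = l := by omega
    rw [this] at htr
    exact hQ _ _ (fun _ => hans) (fun h => absurd ⟨_, htr.good⟩ h) (by omega)
  generalize hj : ρ.r .col = j at *
  -- Naming the product leaves credit conditions that are linear in `X` and `n`.
  obtain ⟨X, hX⟩ : ∃ X : ℤ, X = n * (l - (j + 1)) := ⟨_, rfl⟩
  have hX0 : 0 ≤ X := hX ▸ mul_nonneg (by omega) (by omega)
  have hXn : (n : ℤ) * (l - j) = X + n := by rw [hX]; ring
  rw [hXn] at hR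
  refine wp_trial (r := 1) (P := σ.A .prev) hM hB hP htr hb (a := 0) (by omega) _ _ hc' hj hans
    hprev rfl rfl hfl hst (by omega) _ fun σ1 T1 hf1 h1 hT1 => ?_
  have hf1' := hf1
  obtain ⟨⟨-, -, -, z1, -⟩, -⟩ := hf1'
  rw [Cond.holds_eq, z1]
  refine ⟨fun hz => ?_, fun hz => ?_⟩
  · rcases h1 with ⟨-, ht, hp⟩ | hr
    · refine wp_commit hB hinp (htr.update (by omega)) hb (by omega) _ _ hf1 ht hp (by omega) _
        fun σ2 T2 h2 hc2 hT2 => ⟨by omega, by omega, Or.inl ⟨h2, by omega, ?_⟩⟩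
      rw [hc2]
      push_cast
      rw [← hX]
      omega
    · have := hr.1
      omega
  rcases h1 with ⟨h, -⟩ | ⟨-, hF1, hN1, hne1⟩
  · exact absurd h hz
  obtain ⟨c1, f1, f2, f3, f4, f5, f6⟩ := hf1
  -- Column `j` still holds the preset value 1 of the failed trial with `a = 0`; the flips of that
  -- trial were never written to `val`.
  refine wp_trial (r := 1) (P := σ.A .prev) hM hB hP (htr.update (b := 1) (by omega)) hb (a := 1)
    (by omega) _ _ c1 f1 f3 f4 f5 f6 (fun c => by have := hF1 c; omega)
    (fun i => by have := hN1 i; omega) (by omega) _ fun σ2 T2 hf2 h2 hT2 => ?_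
  have hf2' := hf2
  obtain ⟨⟨-, q2, -, z2, -⟩, -⟩ := hf2'
  simp only [Cond.holds_eq, z2]
  refine ⟨fun hz => ?_, fun hz => ?_⟩
  · rcases h2 with ⟨-, ht, hp⟩ | hr
    · refine wp_commit hB hinp ((htr.update (by omega)).update (by omega)) hb (by omega) _ _ hf2 ht
        hp (by omega) _ fun σ3 T3 h3 hc3 hT3 => ⟨by omega, by omega, Or.inl ⟨h3, by omega, ?_⟩⟩
      rw [hc3]
      push_cast
      rw [← hX]
      omega
    · have := hr.1
      omega
  rcases h2 with ⟨h, -⟩ | ⟨-, -, -, hne2⟩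
  · exact absurd h hz
  refine ⟨by omega, by omega, by omega, Or.inr ⟨by simpa using q2, by simp, by simpa using q2, ?_⟩⟩
  rintro ⟨w, hw⟩
  have h3 := hw.1 j
  have h4 := hne1 w (hw.mono hb)
  have h5 := hne2 w (hw.mono hb)
  omega

end

/-! ### The whole algorithm -/

/-- The algorithm. -/
noncomputable def solve : Cmd :=
  .set .one 1 ;;
  .ite (.eq .cells .zero) (.set .ans 1)
    (buildPrev ;; findDirty ;; .set .tmpA 5 ;;
      .ite (.lt .dirties .tmpA) (markTypes ;; decisionTree TypesCompletable 81 fun _ => False)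
        assignColumns)

theorem DMC_of_mul_eq_zero {n l : ℕ} (S : IncMatrix n l) (h : n * l = 0) : DMC 0 2 n l S := by
  have hno : ∀ (i : Fin n) (j : Fin l), False := fun i j => by
    have := Nat.mul_pos i.pos j.pos
    omega
  refine (DMC_zero_iff S).2 ⟨fun _ _ => false, fun i j => (hno i j).elim, fun i i' => ?_⟩
  simp

theorem wp_solve {n l B : ℕ} (S : IncMatrix n l) (hB : 4 * (n * l) + 10 * n + 10 * l + 200 ≤ B)
    (σ : St) (T : ℤ) (h1 : σ.r .rows = n) (h2 : σ.r .cols = l) (h3 : σ.r .cells = n * l)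
    (h4 : σ.r .zero = 0) (hA : ∀ a q, σ.A a q = 0) (hT : 2000 * (n * l + 1) ≤ T)
    (Q : St → ℤ → Prop) (hQ : ∀ σ' T', (DMC 0 2 n l S → σ'.r .ans = 1) →
      (¬ DMC 0 2 n l S → σ'.r .ans = 0) → 0 ≤ T' → Q σ' T') :
    wp B (n * l) (input S).mem solve Q σ T := by
  obtain ⟨M, hM⟩ : ∃ M, M = n * l := ⟨_, rfl⟩
  have hMT : 2000 * ((M : ℤ) + 1) ≤ T := by rw [hM]; exact_mod_cast hT
  rw [← hM] at hB h3 ⊢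
  have hinp := input_mem_le S
  simp only [solve, wp, Cond.holds_eq, St.setr_r, reduceCtorEq, if_false, h3, h4]
  refine ⟨by omega, fun h0 => ⟨by omega, ?_⟩, fun h0 => ?_⟩
  · exact hQ _ _ (fun _ => by simp)
      (fun h => absurd (DMC_of_mul_eq_zero S (hM.symm.trans h0)) h) (by omega)
  have hn : 0 < n := Nat.pos_of_ne_zero (by rintro rfl; simp at hM; omega)
  have hl : 0 < l := Nat.pos_of_ne_zero (by rintro rfl; simp at hM; omega)
  -- For a nonempty matrix the terms linear in `n` and `l` are absorbed by `n * l`.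
  have hnM : n ≤ M := hM ▸ Nat.le_mul_of_pos_right n hl
  have hlM : l ≤ M := hM ▸ Nat.le_mul_of_pos_left l hn
  refine wp_buildPrev hM hl hB _ _ (by simp [Consts, *]) (by simp [hA]) (by omega) _
    fun σ1 T1 c1 hP1 hA1 hT1 => ?_
  refine wp_findDirty hM hB _ _ c1 hP1 (by omega) _ fun σ2 T2 c2 hD hA2 hT2 => ?_
  have hA2' : ∀ a, a ≠ .prev → a ≠ .dirty → ∀ q, σ2.A a q = 0 := fun a ha ha' q => by
    rw [hA2 a ha', hA1 a ha, St.setr_A, hA]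
  refine ⟨by omega, fun h => ?_, fun h => ?_⟩ <;>
    simp only [Cond.holds_lt, St.setr_r, reduceCtorEq, if_true, if_false] at h
  · have hd : ∀ k < σ2.r .dirties, σ2.A .dirty k < l := fun k hk => by
      have : σ2.A .dirty k ∈ dirtyList n l (input S).mem l :=
        hD ▸ List.mem_map_of_mem (List.mem_range.2 hk)
      exact (mem_dirtyList.1 this).1
    refine wp_markTypes hM (fun q _ => hinp q) hB _ _ (by simpa [Consts] using c2)
      (by simpa using hd) (by simpa using hA2' .mark (by simp) (by simp)) (by omega) _
      fun σ3 T3 c3 hm hT3 => ?_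
    have key := DMC_iff_typesCompletable S _ _ (by omega) hD
    have e : (fun q => (q < 81 ∧ σ3.A .mark q = 1) ∨ False) = fun q => ∃ i < n,
        rowType (σ2.r .dirties) (σ2.A .dirty) (input S).mem (i * l) = q := by
      funext q
      rw [eq_iff_iff, or_false, hm]
      simp only [St.setr_r, St.setr_A, reduceCtorEq, if_false]
      refine ⟨And.right, fun hq => ⟨?_, hq⟩⟩
      obtain ⟨i, hi, rfl⟩ := hq
      exact rowType_lt _ _ _ _ fun k => digitVal_le (M := M) (fun q _ => hinp q) fun hk => by
        have := hd k hk
        have := Nat.mul_le_mul_right l (Nat.succ_le_of_lt hi)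
        rw [Nat.succ_mul] at this
        omega
    refine wp_decisionTree _ _ (by omega) (by omega) _ _ _ _ c3.2.2.2.2 fun σ4 T4 hy hno hT4 =>
      hQ _ _ (fun hd => hy ?_) (fun hd => hno ?_) (by push_cast at hT4; omega)
    · rwa [e, ← key]
    · rwa [e, ← key]
  · have h5 : 5 ≤ (dirtyCols S).card := by
      rw [← length_dirtyList S, ← hD, List.length_map, List.length_range]
      omega
    have key := (DMC_iff_conRMC S h5).trans (conRMC_one_iff S)
    have ep : σ2.A .prev = σ1.A .prev := funext (hA2 .prev (by simp))
    refine wp_assignColumns hM hn hB hinp _ _ (by simpa [Consts] using c2) (by simpa [ep] using hP1)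
      (by simpa using hA2' .val (by simp) (by simp)) (by simpa using hA2' .flip (by simp) (by simp))
      (by simpa using hA2' .stamp (by simp) (by simp)) (by omega) _ fun σ3 T3 hy hno hT3 =>
      hQ _ _ (fun hd => hy (key.1 hd)) (fun hd => hno (mt key.2 hd)) (by omega)

/-- The algorithm as a machine program. -/
noncomputable def solver : Program :=
  .seq (.assign 2 (.const 16)) (.seq (.assign 3 (.mul 0 1)) (.seq (.assign 4 (.copy 0))
    (.seq (.assign 5 (.copy 1)) (.seq (.assign 6 (.copy 3))
      (.seq solve.compile (.assign 0 (.copy Reg.ans.idx)))))))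

/-- The initial state of the structured language. -/
def initialState (n l : ℕ) : St where
  r x := match x with
    | .rows => n
    | .cols => l
    | .cells => n * l
    | _ => 0
  A _ _ := 0

/-- The memory beyond the input is zero, so all arrays start out zero without an initialisation
loop. -/
theorem layout_zero {n l : ℕ} (S : IncMatrix n l) :
    layout (n * l) (input S).mem (fun _ _ => 0) = (input S).mem := by
  funext q
  unfold layout
  split_ifs with h1 h2
  · rfl
  · simp [input, h1]
  · simp [input, h1]

theorem solvableInTime_DMC : SolvableInTime (DMC 0 2) fun n l => n * l + 1 := by
  refine ⟨solver, 5000, fun n l S => ?_⟩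
  -- Named registers and array cells hold at most `B`; the factor 5000 leaves room for the
  -- addresses, which reach about `16 * 300 = 4800` times `(n + 1) * (l + 1)`.
  obtain ⟨B, hB⟩ : ∃ B, B = 300 * ((n + 1) * (l + 1)) := ⟨_, rfl⟩
  obtain ⟨W, hWd⟩ : ∃ W, W = 5000 * ((n + 1) * (l + 1)) := ⟨_, rfl⟩
  have hexp : (n + 1) * (l + 1) = n * l + n + l + 1 := by ring
  rw [hexp] at hB hWd
  have hBge : 4 * (n * l) + 10 * n + 10 * l + 200 ≤ B := by omega
  have hW : 16 * B + n * l + 16 ≤ W := by omega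
  rw [hexp, ← hWd]
  have hw := wp_solve S hBge (initialState n l) (2000 * (n * l + 1)) rfl rfl rfl rfl
    (fun _ _ => rfl) le_rfl (fun σ' T' => (DMC 0 2 n l S → σ'.r .ans = 1) ∧
      (¬ DMC 0 2 n l S → σ'.r .ans = 0) ∧ 0 ≤ T') fun _ _ h1 h2 h3 => ⟨h1, h2, h3⟩
  let reg : ℕ → ℕ := Function.update (Function.update (Function.update (Function.update
    (Function.update (input S).reg 2 16) 3 (n * l)) 4 n) 5 l) 6 (n * l)
  have hrep : Represents B (n * l) (input S).mem (initialState n l) ⟨reg, (input S).mem⟩ := by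
    refine ⟨fun x => ?_, by simp [reg], by simp [reg], (layout_zero S).symm, fun x => ?_,
      fun _ _ => by simp [initialState]⟩
    · cases x <;> simp [reg, Reg.idx, initialState, input]
    · cases x <;> simp only [initialState] <;> omega
  obtain ⟨t, s', σ', hex, hr', hyes, hno, ht⟩ := exec_of_wp hW
    (fun q _ => (input_mem_le S q).trans (by omega)) solve _ _ _ hw _ hrep
  have hans := hr'.reg .ans
  have hle := hr'.reg_le .ans
  refine ⟨1 + (1 + (1 + (1 + (1 + (t + 1))))), _,
    .seq (exec_assign_of_eq 2 _ (v := 16) rfl (by omega))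
    (.seq (exec_assign_of_eq 3 _ (v := n * l) (by simp [Operation.value, input]) (by omega))
    (.seq (exec_assign_of_eq 4 _ (v := n) (by simp [Operation.value, input]) (by omega))
    (.seq (exec_assign_of_eq 5 _ (v := l) (by simp [Operation.value, input]) (by omega))
    (.seq (exec_assign_of_eq 6 _ (v := n * l) (by simp [Operation.value]) (by omega))
    (.seq hex (exec_assign_of_eq 0 _ (v := σ'.r .ans) hans (by omega))))))), ?_, ?_, ?_⟩
  · have : (t : ℤ) ≤ 2000 * (n * l + 1) := by linarith
    have : t ≤ 2000 * (n * l + 1) := by exact_mod_cast this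
    show _ ≤ 5000 * (n * l + 1)
    omega
  · simpa using hyes
  · simpa using hno

end MatrixCompletion

theorem mainTheorem8 :
    MatrixCompletion.SolvableInTime (MatrixCompletion.DMC 0 2) (fun n l => n * l + 1) ∧
    (∀ (n l : ℕ) (T : MatrixCompletion.BinMatrix n l),
      5 ≤ (MatrixCompletion.dirtyCols (MatrixCompletion.liftMatrix T)).card →
      MatrixCompletion.delta T ≤ 2 → MatrixCompletion.RadiusLE T 1) ∧
    (∀ (n l : ℕ) (S : MatrixCompletion.IncMatrix n l),
      5 ≤ (MatrixCompletion.dirtyCols S).card →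
      (MatrixCompletion.DMC 0 2 n l S ↔ MatrixCompletion.ConRMC S (fun _ => 1))) :=
  ⟨MatrixCompletion.solvableInTime_DMC,
    fun _ _ T h5 hd => MatrixCompletion.radiusLE_one_of_delta_le_two T h5 hd,
    fun _ _ S h5 => MatrixCompletion.DMC_iff_conRMC S h5⟩
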